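/- For a finite simple graph $G$ and $g\in\{3,4,\dots\}\cup\{\infty\}$, let the $g$-girth-thickness $\theta(g,G)$ be the smallest number of planar subgraphs of girth at least $g$ whose union is $G$ (it suffices to cover the edges, so $\theta(g,G)=0$ if $G$ has no edges; the girth of an acyclic graph is $\infty$). If $G$ has vertices $w_1,\dots,w_n$, let $G\bowtie G$ be the graph with the $2n$ vertices $u_1,\dots,u_n,v_1,\dots,v_n$ in which, for $x,y\in\{u,v\}$, the vertices $x_i$ and $y_j$ are adjacent if and only if $w_iw_j$ is an edge of $G$. **Theorem.** Let $G$ be a simple graph with $n\ge 2$ vertices and $e$ edges. Then \[\left\lceil \frac{e}{n-1}\right\rceil \le \theta(4,G\bowtie G)\le \theta(\infty,G),\] and $\theta(\infty,G)$ is the arboricity of $G$, that is, the smallest number of forests whose union is $G$. -/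

import Mathlib

/-- `S` is a simple arc in the Euclidean plane with the two ends `a` and `b`: the image of an
injective continuous map `[0, 1] → ℝ²` that sends `0` to `a` and `1` to `b`. -/
def IsPlaneArc (a b : EuclideanSpace ℝ (Fin 2)) (S : Set (EuclideanSpace ℝ (Fin 2))) : Prop :=
  ∃ γ : Path a b, Function.Injective γ ∧ Set.range γ = S

/-- A graph is planar if it can be drawn in the Euclidean plane without crossings: the vertices are
distinct points, every edge is a simple arc joining its two ends, an arc passes through no vertex
other than its own ends, and two different arcs meet only in common ends of the two edges. -/
def SimpleGraph.IsPlanarGraph {V : Type*} (G : SimpleGraph V) : Prop :=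
  ∃ (p : V → EuclideanSpace ℝ (Fin 2)) (A : Sym2 V → Set (EuclideanSpace ℝ (Fin 2))),
    Function.Injective p ∧
    (∀ u v : V, G.Adj u v → IsPlaneArc (p u) (p v) (A s(u, v))) ∧
    (∀ w : V, ∀ e ∈ G.edgeSet, p w ∈ A e → w ∈ e) ∧
    (∀ e ∈ G.edgeSet, ∀ f ∈ G.edgeSet, e ≠ f → A e ∩ A f ⊆ p '' {w | w ∈ e ∧ w ∈ f})

/-- The `g`-girth-thickness of `G`: the smallest number of planar subgraphs of girth at least `g`
whose union is `G` (and `⊤` if there is no such finite family). An acyclic graph has girth `⊤`.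
Subgraphs are taken to be spanning; isolated vertices affect neither planarity nor the girth. -/
noncomputable def SimpleGraph.girthThickness {V : Type*} (g : ℕ∞) (G : SimpleGraph V) : ℕ∞ :=
  ⨅ (k : ℕ) (_ : ∃ H : Fin k → SimpleGraph V,
    (∀ i, (H i).IsPlanarGraph ∧ g ≤ (H i).egirth) ∧ ⨆ i, H i = G), (k : ℕ∞)

/-- The arboricity of `G`: the smallest number of forests whose union is `G`
(and `⊤` if there is no such finite family). -/
noncomputable def SimpleGraph.arboricity {V : Type*} (G : SimpleGraph V) : ℕ∞ :=
  ⨅ (k : ℕ) (_ : ∃ H : Fin k → SimpleGraph V,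
    (∀ i, (H i).IsAcyclic) ∧ ⨆ i, H i = G), (k : ℕ∞)

/-- The graph `G ⋈ G`. Each vertex `w` of `G` has the two copies `(w, false)` and `(w, true)`, and
a copy of `w` is adjacent to a copy of `w'` if and only if `w w'` is an edge of `G`. -/
def SimpleGraph.doubled {V : Type*} (G : SimpleGraph V) : SimpleGraph (V × Bool) where
  Adj x y := G.Adj x.1 y.1
  symm := ⟨fun _ _ h => G.symm.symm _ _ h⟩
  loopless := ⟨fun x h => G.loopless.irrefl x.1 h⟩

/-! Upper bound. If forests `H i` cover `G`, their doubles cover `G.doubled`. A triangle in a double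
projects to a triangle below, so the double of a forest has girth at least 4. It is also planar:
delete a vertex `v` with at most one neighbour `u`, draw the double of the rest with straight
segments, and put the two copies of `v` into a thin empty triangle on the segment between the two
copies of `u` (`IsStraightDrawing.exists_insert_pair`). To keep such a segment available, the
induction also draws an edge between the two copies of each vertex. A forest embeds in its own
double, so it is planar, and the planarity condition in the case of girth `⊤` is redundant; this
identifies that thickness with the arboricity.

Lower bound. The double has `4e` edges and `2n` vertices, and a triangle-free planar graph on `m ≥
3` vertices has at most `2m - 4` edges, so each layer covers at most `4(n - 1)` edges.

This edge bound is Euler's inequality, proved without the Jordan curve theorem. A plane drawing is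
discretised on a fine mesh, which makes the graph a minor of the square grid
(`IsPlanarGraph.isGridMinor`). In the grid every finite mod 2 cycle bounds a set of unit squares
(`exists_eq_squares_of_cycle`). Gluing squares across the grid edges that the minor does not use
produces faces; their boundaries span the cycle space, and every edge has just two sides. The face
boundaries sum to zero, so at least `dim + 1` of them are nonzero; each of these has at least 4
edges, whence `4 (dim + 1) ≤ 2 |E|`. Combine this with `dim ≥ |E| - |V| + 1`. -/

/-! ### MacLane's count and the cycle space modulo 2 -/

open Module in
/-- **MacLane's count.** If a subspace `Z` of `𝔽₂^E` is spanned by the boundaries of "faces", where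
every `e` has the two faces `l e` and `r e` on its sides, and if every nonzero member of `Z` has at
least `g` nonzero entries, then `g (dim Z + 1) ≤ 2 |E|`, unless `Z = 0`. -/
theorem mul_finrank_add_one_le_of_faces {E Φ : Type*} [Fintype E] [DecidableEq Φ]
    (Z : Submodule (ZMod 2) (E → ZMod 2)) (l r : E → Φ)
    (hmem : ∀ f, (fun e => (if l e = f then (1 : ZMod 2) else 0) + (if r e = f then 1 else 0)) ∈ Z)
    (hspan : ∀ c ∈ Z, ∃ h : Φ → ZMod 2, ∀ e, c e = h (l e) + h (r e)) (g : ℕ)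
    (hg : ∀ c ∈ Z, c ≠ 0 → g ≤ (Finset.univ.filter (fun e => c e ≠ 0)).card) (hZ : Z ≠ ⊥) :
    g * (finrank (ZMod 2) Z + 1) ≤ 2 * Fintype.card E := by
  classical
  set b : Φ → E → ZMod 2 := fun f e => (if l e = f then 1 else 0) + (if r e = f then 1 else 0)
    with hb
  set I : Finset Φ := Finset.univ.image l ∪ Finset.univ.image r with hI
  -- Faces with zero boundary (the same face on both sides of each of its edges) are discarded: the
  -- bound `g` applies to nonzero members of `Z` only.
  set F : Finset Φ := I.filter (fun f => b f ≠ 0) with hF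
  have hl : ∀ e, l e ∈ I := fun e => by simp [hI]
  have hr : ∀ e, r e ∈ I := fun e => by simp [hI]
  have hsum : ∀ (h : Φ → ZMod 2) (e : E), ∑ f : F, h f * b f e = h (l e) + h (r e) := by
    intro h e
    rw [Finset.sum_coe_sort F (fun f => h f * b f e), hF, Finset.sum_filter_of_ne]
    · simp [hb, mul_add, Finset.sum_add_distrib, hl, hr]
    · intro f _ hf h0
      apply hf
      rw [h0]; simp
  set D : (F → ZMod 2) →ₗ[ZMod 2] (E → ZMod 2) :=
    Fintype.linearCombination (ZMod 2) (fun f : F => b f) with hD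
  have hDapp : ∀ (h : Φ → ZMod 2) (e : E), D (fun f => h f) e = h (l e) + h (r e) := by
    intro h e
    rw [← hsum h e, hD, Fintype.linearCombination_apply]
    simp
  have hle : Z ≤ LinearMap.range D := by
    intro c hc
    obtain ⟨h, hh⟩ := hspan c hc
    exact ⟨fun f => h f, by ext e; rw [hDapp, hh]⟩
  -- Every edge has two sides, so the sum of all faces has zero boundary. This relation is the
  -- source of the `+ 1`.
  have hone : D (fun _ => 1) = 0 := by
    ext e
    rw [hDapp (fun _ => 1) e]
    exact CharTwo.add_self_eq_zero 1
  have hFne : Nonempty F := by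
    by_contra hne
    rw [not_nonempty_iff] at hne
    apply hZ
    rw [eq_bot_iff]
    intro c hc
    obtain ⟨h, rfl⟩ := hle hc
    have : h = 0 := Subsingleton.elim _ _
    simp [this]
  have hker : 0 < finrank (ZMod 2) (LinearMap.ker D) := by
    rw [Module.finrank_pos_iff_exists_ne_zero]
    refine ⟨⟨fun _ => 1, hone⟩, fun h => ?_⟩
    have := congrFun (congrArg Subtype.val h) hFne.some
    simp at this
  have hrk := LinearMap.finrank_range_add_finrank_ker D
  have hZr := Submodule.finrank_mono hle
  have hcard : finrank (ZMod 2) Z + 1 ≤ F.card := by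
    simp at hrk
    omega
  calc g * (finrank (ZMod 2) Z + 1) ≤ g * F.card := Nat.mul_le_mul_left _ hcard
    _ = ∑ f ∈ F, g := by simp [mul_comm]
    _ ≤ ∑ f ∈ F, (Finset.univ.filter (fun e => b f e ≠ 0)).card :=
        Finset.sum_le_sum fun f hf => hg _ (hmem f) (Finset.mem_filter.1 hf).2
    _ ≤ ∑ f ∈ F, ∑ e : E, ((if l e = f then 1 else 0) + (if r e = f then 1 else 0)) := by
        refine Finset.sum_le_sum fun f _ => ?_
        rw [Finset.card_filter]
        refine Finset.sum_le_sum fun e _ => ?_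
        simp only [hb]
        split_ifs <;> simp_all
    _ = ∑ e : E, ∑ f ∈ F, ((if l e = f then 1 else 0) + (if r e = f then 1 else 0)) :=
        Finset.sum_comm
    _ ≤ ∑ e : E, 2 := by
        refine Finset.sum_le_sum fun e _ => ?_
        rw [Finset.sum_add_distrib, Finset.sum_ite_eq, Finset.sum_ite_eq]
        split_ifs <;> omega
    _ = 2 * Fintype.card E := by simp [mul_comm]

/-- The space of cycles modulo 2 of a multigraph with the edges `E`, given by the two ends of every
edge. -/
def cycleSpace {E V : Type*} [Fintype E] [DecidableEq V] (s t : E → V) :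
    Submodule (ZMod 2) (E → ZMod 2) :=
  LinearMap.ker (Fintype.linearCombination (ZMod 2)
    (fun e => (Pi.single (s e) 1 + Pi.single (t e) 1 : V → ZMod 2)))

theorem mem_cycleSpace {E V : Type*} [Fintype E] [DecidableEq V] {s t : E → V}
    {c : E → ZMod 2} : c ∈ cycleSpace s t ↔
      ∀ v, ∑ e, c e * ((if s e = v then 1 else 0) + (if t e = v then 1 else 0)) = 0 := by
  rw [cycleSpace, LinearMap.mem_ker, Fintype.linearCombination_apply, funext_iff]
  simp [Pi.single_apply, mul_add, eq_comm]

-- Rank-nullity for the boundary map: every boundary has coordinate sum zero, so the rank is at most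
-- `|V| - 1`. Connectedness would only be needed for equality.
open Module in
theorem card_add_one_le_finrank_cycleSpace {E V : Type*} [Fintype E] [Fintype V] [DecidableEq V]
    [Nonempty V] (s t : E → V) :
    Fintype.card E + 1 ≤ finrank (ZMod 2) (cycleSpace s t) + Fintype.card V := by
  set D := Fintype.linearCombination (ZMod 2)
    (fun e => (Pi.single (s e) 1 + Pi.single (t e) 1 : V → ZMod 2)) with hD
  have hrk := LinearMap.finrank_range_add_finrank_ker D
  set σ : (V → ZMod 2) →ₗ[ZMod 2] ZMod 2 := Fintype.linearCombination (ZMod 2) (fun _ => 1) with hσ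
  have hσrk := LinearMap.finrank_range_add_finrank_ker σ
  have hsurj : LinearMap.range σ = ⊤ := by
    rw [LinearMap.range_eq_top]
    intro a
    exact ⟨Pi.single (Classical.arbitrary V) a, by simp [hσ, Fintype.linearCombination_apply]⟩
  have hle : LinearMap.range D ≤ LinearMap.ker σ := by
    rintro _ ⟨c, rfl⟩
    have hDc : D c = ∑ e, c e • (Pi.single (s e) 1 + Pi.single (t e) 1 : V → ZMod 2) :=
      Fintype.linearCombination_apply ..
    rw [LinearMap.mem_ker, hDc, map_sum]
    refine Finset.sum_eq_zero fun e _ => ?_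
    simp [hσ, Fintype.linearCombination_apply, Finset.sum_add_distrib, ← Finset.mul_sum,
      CharTwo.add_self_eq_zero]
  have := Submodule.finrank_mono hle
  rw [hsurj, finrank_top] at hσrk
  have hZ : finrank (ZMod 2) (cycleSpace s t) = finrank (ZMod 2) (LinearMap.ker D) := rfl
  simp at hrk hσrk
  omega

/-- A nonzero mod 2 cycle of a triangle-free simple graph has at least four edges. -/
theorem four_le_card_support_of_mem_cycleSpace {V : Type*} [DecidableEq V] {G : SimpleGraph V}
    [Fintype G.edgeSet] (h3 : ∀ a b c, G.Adj a b → G.Adj b c → G.Adj c a → False)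
    {s t : G.edgeSet → V} (hst : ∀ e : G.edgeSet, (e : Sym2 V) = s(s e, t e)) {c : G.edgeSet → ZMod 2}
    (hc : c ∈ cycleSpace s t) (h0 : c ≠ 0) :
    4 ≤ (Finset.univ.filter (fun e => c e ≠ 0)).card := by
  classical
  rw [mem_cycleSpace] at hc
  have hne : ∀ e, s e ≠ t e := by
    intro e
    have := e.2
    rw [hst e] at this
    exact G.ne_of_adj this
  -- every end of an edge of the cycle lies on a second edge of the cycle
  have step : ∀ u v, (huv : G.Adj u v) → c ⟨s(u, v), huv⟩ ≠ 0 →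
      ∃ w, w ≠ u ∧ ∃ h : G.Adj v w, c ⟨s(v, w), h⟩ ≠ 0 := by
    intro u v huv hcuv
    by_contra! hcon
    have hsum := hc v
    rw [Finset.sum_eq_single ⟨s(u, v), huv⟩] at hsum
    · have h1 := hst (⟨s(u, v), huv⟩ : G.edgeSet)
      have h2 := hne ⟨s(u, v), huv⟩
      simp only [Sym2.eq_iff] at h1
      rcases h1 with ⟨h, h'⟩ | ⟨h, h'⟩ <;> simp [← h, ← h', huv.ne, hcuv] at hsum
    · intro e _ he
      by_cases hce : c e = 0
      · simp [hce]
      have h1 := hst e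
      have hs : s e ≠ v := by
        intro hs
        have hadj : G.Adj v (t e) := by
          have := e.2
          rw [h1, hs] at this
          exact this
        have heq : e = ⟨s(v, t e), hadj⟩ := Subtype.ext (h1.trans (by rw [hs]))
        by_cases ht : t e = u
        · exact he (Subtype.ext (by rw [h1, hs, ht, Sym2.eq_swap]))
        · exact hce (by rw [heq]; exact hcon _ ht hadj)
      have ht : t e ≠ v := by
        intro ht
        have hadj : G.Adj v (s e) := by
          have := e.2
          rw [h1, ht] at this
          exact SimpleGraph.Adj.symm this
        have heq : e = ⟨s(v, s e), hadj⟩ := Subtype.ext (h1.trans (by rw [ht, Sym2.eq_swap]))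
        by_cases hs' : s e = u
        · exact he (Subtype.ext (by rw [h1, ht, hs']))
        · exact hce (by rw [heq]; exact hcon _ hs' hadj)
      simp [hs, ht]
    · simp
  obtain ⟨e, he⟩ : ∃ e, c e ≠ 0 := by
    by_contra! h
    exact h0 (funext h)
  obtain ⟨⟨u, v⟩, huv⟩ := e
  replace huv : G.Adj u v := huv
  replace he : c ⟨s(u, v), huv⟩ ≠ 0 := he
  obtain ⟨w, hwu, hvw, hcw⟩ := step u v huv he
  have he' : c ⟨s(v, u), huv.symm⟩ ≠ 0 := by
    convert he using 2
    exact Subtype.ext Sym2.eq_swap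
  obtain ⟨x, hxv, hux, hcx⟩ := step v u huv.symm he'
  obtain ⟨y, hyv, hwy, hcy⟩ := step v w hvw hcw
  -- The path `x u v w y` supplies the four edges. They are distinct even when `x = y`; only `x = w`
  -- would be harmful, and it closes a triangle.
  have hxw : x ≠ w := by
    rintro rfl
    exact h3 _ _ _ huv hvw hux.symm
  set S : Finset G.edgeSet := {⟨s(u, v), huv⟩, ⟨s(v, w), hvw⟩, ⟨s(u, x), hux⟩, ⟨s(w, y), hwy⟩}
    with hS
  have hcard : S.card = 4 := by
    have := huv.ne; have := hvw.ne; have := hux.ne; have := hwy.ne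
    rw [hS, Finset.card_insert_of_notMem, Finset.card_insert_of_notMem,
      Finset.card_insert_of_notMem, Finset.card_singleton] <;>
    simp <;> grind
  rw [← hcard]
  apply Finset.card_le_card
  intro e
  simp only [hS, Finset.mem_insert, Finset.mem_singleton, Finset.mem_filter, Finset.mem_univ,
    true_and]
  rintro (rfl | rfl | rfl | rfl) <;> assumption

/-! ### The square grid: finite cycles are boundaries -/

/-- The infinite square grid. -/
def squareGrid : SimpleGraph (ℤ × ℤ) where
  Adj p q := (p.1 = q.1 ∧ (q.2 = p.2 + 1 ∨ p.2 = q.2 + 1)) ∨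
    (p.2 = q.2 ∧ (q.1 = p.1 + 1 ∨ p.1 = q.1 + 1))
  symm := ⟨fun p q h => by omega⟩
  loopless := ⟨fun p h => by omega⟩

theorem squareGrid_adj {p q : ℤ × ℤ} : squareGrid.Adj p q ↔
    (p.1 = q.1 ∧ (q.2 = p.2 + 1 ∨ p.2 = q.2 + 1)) ∨
      (p.2 = q.2 ∧ (q.1 = p.1 + 1 ∨ p.1 = q.1 + 1)) := Iff.rfl

/-- The four neighbours of a point of the grid. -/
def gridNeighbors (p : ℤ × ℤ) : Finset (ℤ × ℤ) :=
  {(p.1 + 1, p.2), (p.1 - 1, p.2), (p.1, p.2 + 1), (p.1, p.2 - 1)}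

theorem mem_gridNeighbors {p q : ℤ × ℤ} : q ∈ gridNeighbors p ↔ squareGrid.Adj p q := by
  obtain ⟨a, b⟩ := p
  obtain ⟨c, d⟩ := q
  simp only [gridNeighbors, Finset.mem_insert, Finset.mem_singleton, Prod.mk.injEq,
    squareGrid_adj]
  omega

theorem sum_gridNeighbors {M : Type*} [AddCommMonoid M] (p : ℤ × ℤ) (f : ℤ × ℤ → M) :
    ∑ q ∈ gridNeighbors p, f q = f (p.1 + 1, p.2) + (f (p.1 - 1, p.2) +
      (f (p.1, p.2 + 1) + f (p.1, p.2 - 1))) := by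
  rw [gridNeighbors, Finset.sum_insert, Finset.sum_insert, Finset.sum_insert,
    Finset.sum_singleton] <;>
  simp <;> omega

/-- The unit square above or to the right of a grid edge `pq`, named by its lower left corner. -/
def upperSquare (p q : ℤ × ℤ) : ℤ × ℤ := (min p.1 q.1, min p.2 q.2)

/-- The unit square below or to the left of a grid edge `pq`, named by its lower left corner. -/
def lowerSquare (p q : ℤ × ℤ) : ℤ × ℤ := (max p.1 q.1 - 1, max p.2 q.2 - 1)

theorem upperSquare_comm (p q : ℤ × ℤ) : upperSquare p q = upperSquare q p := by
  simp [upperSquare, min_comm]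

theorem lowerSquare_comm (p q : ℤ × ℤ) : lowerSquare p q = lowerSquare q p := by
  simp [lowerSquare, max_comm]

/-- The coboundary of a function on unit squares is a cycle modulo 2. -/
theorem sum_gridNeighbors_squares_eq_zero (h : ℤ × ℤ → ZMod 2) (p : ℤ × ℤ) :
    ∑ q ∈ gridNeighbors p, (h (upperSquare p q) + h (lowerSquare p q)) = 0 := by
  rw [sum_gridNeighbors]
  simp only [upperSquare, lowerSquare]
  have e1 : ∀ a : ℤ, min a (a + 1) = a := fun a => by omega
  have e2 : ∀ a : ℤ, max a (a + 1) - 1 = a := fun a => by omega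
  have e3 : ∀ a : ℤ, min a (a - 1) = a - 1 := fun a => by omega
  have e4 : ∀ a : ℤ, max a (a - 1) = a := fun a => by omega
  simp only [e1, e2, e3, e4, min_self, max_self]
  have two : (2 : ZMod 2) = 0 := rfl
  linear_combination (h (p.1, p.2) + h (p.1, p.2 - 1) + h (p.1 - 1, p.2) +
    h (p.1 - 1, p.2 - 1)) * two

/-- A finite cycle modulo 2 in the grid is the boundary of a set of unit squares. -/
theorem exists_eq_squares_of_cycle (z : ℤ × ℤ → ℤ × ℤ → ZMod 2) (hsymm : ∀ p q, z p q = z q p)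
    (T : Finset (ℤ × ℤ)) (hT : ∀ p q, z p q ≠ 0 → p ∈ T)
    (hz : ∀ p, ∑ q ∈ gridNeighbors p, z p q = 0) :
    ∃ h : ℤ × ℤ → ZMod 2, ∀ p q, squareGrid.Adj p q →
      z p q = h (upperSquare p q) + h (lowerSquare p q) := by
  obtain ⟨L, hL⟩ : ∃ L : ℤ, ∀ p ∈ T, L < p.2 := by
    obtain ⟨L, hL⟩ := (T.image Prod.snd).bddBelow
    exact ⟨L - 1, fun p hp => by have := hL (Finset.mem_image_of_mem Prod.snd hp); omega⟩
  have hz0 : ∀ p q, p.2 ≤ L → z p q = 0 := fun p q hp => by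
    by_contra h
    have := hL p (hT p q h)
    omega
  -- The parity of the crossings of `z` with the ray going down from the centre of the square; below
  -- the level `L` there are none.
  set H : ℤ × ℤ → ZMod 2 := fun s => ∑ k ∈ Finset.Ioc L s.2, z (s.1, k) (s.1 + 1, k) with hH
  have two : (2 : ZMod 2) = 0 := rfl
  have hor : ∀ i j, z (i, j) (i + 1, j) = H (i, j) + H (i, j - 1) := by
    intro i j
    by_cases hj : j ≤ L
    · simp only [hH]
      rw [Finset.Ioc_eq_empty (by simpa using hj),
        Finset.Ioc_eq_empty (by simp only [not_lt]; omega), hz0 _ _ hj]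
      simp
    · simp only [hH]
      have : Finset.Ioc L j = insert j (Finset.Ioc L (j - 1)) := by
        ext k; simp; omega
      rw [this, Finset.sum_insert (by simp)]
      linear_combination -(∑ x ∈ Finset.Ioc L (j - 1), z (i, x) (i + 1, x)) * two
  -- Induction on the height: both sides vanish up to level `L`, and the cycle condition at `(i, j +
  -- 1)` carries the identity from one vertical edge to the next.
  have ver : ∀ i j, z (i, j) (i, j + 1) = H (i, j) + H (i - 1, j) := by
    intro i j
    by_cases hj : j ≤ L
    · simp only [hH]
      rw [Finset.Ioc_eq_empty (by simpa using hj), hz0 _ _ hj]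
      simp
    · push Not at hj
      induction j, hj.le using Int.leInduction with
      | base => omega
      | succ j hj' ih =>
        have ih' : z (i, j) (i, j + 1) = H (i, j) + H (i - 1, j) := by
          rcases hj'.eq_or_lt with rfl | h
          · simp only [hH]
            rw [hz0 _ _ le_rfl]
            simp
          · exact ih h
        have h1 := hz (i, j + 1)
        rw [sum_gridNeighbors] at h1
        have h2 := hor i (j + 1)
        have h3 := hor (i - 1) (j + 1)
        simp only [add_sub_cancel_right, sub_add_cancel] at h1 h2 h3
        rw [hsymm (i, j + 1) (i - 1, j + 1), hsymm (i, j + 1) (i, j), h2, h3, ih'] at h1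
        linear_combination h1 - (H (i, j) + H (i - 1, j) + H (i, j + 1) +
          H (i - 1, j + 1)) * two
  refine ⟨H, ?_⟩
  have key : ∀ p q : ℤ × ℤ, (q = (p.1, p.2 + 1) ∨ q = (p.1 + 1, p.2)) →
      z p q = H (upperSquare p q) + H (lowerSquare p q) := by
    rintro ⟨i, j⟩ q (rfl | rfl)
    · rw [ver]
      simp [upperSquare, lowerSquare]
    · rw [hor]
      simp [upperSquare, lowerSquare]
  intro p q hpq
  have : (q = (p.1, p.2 + 1) ∨ q = (p.1 + 1, p.2)) ∨
      (p = (q.1, q.2 + 1) ∨ p = (q.1 + 1, q.2)) := by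
    obtain ⟨a, b⟩ := p
    obtain ⟨c, d⟩ := q
    simp only [squareGrid_adj] at hpq
    simp only [Prod.mk.injEq]
    omega
  rcases this with h | h
  · exact key p q h
  · rw [hsymm, upperSquare_comm, lowerSquare_comm]
    exact key q p h

/-- Two points of a connected part of the grid are the ends of a mod 2 chain inside it. -/
theorem exists_chain_of_reachable (B : Set (ℤ × ℤ)) {x y : B}
    (h : (squareGrid.induce B).Reachable x y) :
    ∃ z : ℤ × ℤ → ℤ × ℤ → ZMod 2, (∀ p q, z p q = z q p) ∧
      (∀ p q, z p q ≠ 0 → squareGrid.Adj p q ∧ p ∈ B ∧ q ∈ B) ∧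
      ∀ p, ∑ q ∈ gridNeighbors p, z p q =
        (if (x : ℤ × ℤ) = p then 1 else 0) + (if (y : ℤ × ℤ) = p then 1 else 0) := by
  obtain ⟨w⟩ := h
  induction w with
  | nil =>
    refine ⟨0, by simp, by simp, fun p => ?_⟩
    simp [CharTwo.add_self_eq_zero]
  | @cons a b c hab w ih =>
    obtain ⟨z, hs, hB, hz⟩ := ih
    have hab' : squareGrid.Adj (a : ℤ × ℤ) b := hab
    have hne : (a : ℤ × ℤ) ≠ b := hab'.ne
    refine ⟨fun p q => z p q + ((if p = a ∧ q = b then 1 else 0) +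
      (if p = b ∧ q = a then 1 else 0)), fun p q => ?_, fun p q hpq => ?_, fun p => ?_⟩
    · beta_reduce
      rw [hs p q]
      simp only [and_comm, add_comm]
    · by_cases h1 : p = a ∧ q = b
      · rw [h1.1, h1.2]
        exact ⟨hab', a.2, b.2⟩
      by_cases h2 : p = b ∧ q = a
      · rw [h2.1, h2.2]
        exact ⟨hab'.symm, b.2, a.2⟩
      simp only [h1, h2, if_false, add_zero] at hpq
      exact hB p q hpq
    · rw [Finset.sum_add_distrib, hz]
      have key : ∀ u v : ℤ × ℤ, squareGrid.Adj u v →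
          ∑ q ∈ gridNeighbors p, (if p = u ∧ q = v then (1 : ZMod 2) else 0) =
            if u = p then 1 else 0 := by
        intro u v huv
        by_cases hp : p = u
        · subst hp
          simp [mem_gridNeighbors, huv]
        · simp [hp, Ne.symm hp]
      rw [Finset.sum_add_distrib, key _ _ hab', key _ _ hab'.symm]
      have two : (2 : ZMod 2) = 0 := rfl
      linear_combination (if (b : ℤ × ℤ) = p then (1 : ZMod 2) else 0) * two

/-! ### Cycles of a grid minor and cycles of the grid -/

/-- A model, as a minor of the square grid, of the graph with the vertices `V` and the edges `E`,
where the edge `e` has the ends `s e` and `t e`: the vertices are represented by disjoint connected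
sets of grid points, and the edge `e` by a grid edge between `x e` and `y e`. -/
structure GridModel (V E : Type*) where
  B : V → Finset (ℤ × ℤ)
  s : E → V
  t : E → V
  x : E → ℤ × ℤ
  y : E → ℤ × ℤ
  eq_of_mem : ∀ {p u v}, p ∈ B u → p ∈ B v → u = v
  connected : ∀ v, (squareGrid.induce (B v : Set (ℤ × ℤ))).Connected
  x_mem : ∀ e, x e ∈ B (s e)
  y_mem : ∀ e, y e ∈ B (t e)
  adj : ∀ e, squareGrid.Adj (x e) (y e)
  s_ne_t : ∀ e, s e ≠ t e
  eq_of_ends : ∀ e f, (s e = s f ∧ t e = t f) ∨ (s e = t f ∧ t e = s f) → e = f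

namespace GridModel

variable {V E : Type*} (M : GridModel V E)

/-- The grid edges used by the model. -/
def Used (p q : ℤ × ℤ) : Prop :=
  (∃ v, p ∈ M.B v ∧ q ∈ M.B v) ∨ ∃ e, (p = M.x e ∧ q = M.y e) ∨ (p = M.y e ∧ q = M.x e)

theorem used_comm {p q : ℤ × ℤ} : M.Used p q ↔ M.Used q p := by
  unfold Used
  simp only [and_comm, or_comm]

theorem mem_biUnion_of_used [Fintype V] [DecidableEq V] {p q : ℤ × ℤ} (h : M.Used p q) :
    p ∈ Finset.univ.biUnion M.B := by
  rw [Finset.mem_biUnion]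
  rcases h with ⟨v, h, -⟩ | ⟨e, ⟨rfl, -⟩ | ⟨rfl, -⟩⟩
  · exact ⟨v, Finset.mem_univ _, h⟩
  · exact ⟨_, Finset.mem_univ _, M.x_mem e⟩
  · exact ⟨_, Finset.mem_univ _, M.y_mem e⟩

/-- Contracting the branch sets maps cycles to cycles: in the sum of the cycle conditions over `B
v`, grid edges inside `B v` are counted twice and cancel, and the edges leaving `B v` are those that
represent an edge at `v`. -/
theorem mem_cycleSpace_of_cycle [Fintype V] [DecidableEq V] [Fintype E]
    (z : ℤ × ℤ → ℤ × ℤ → ZMod 2) (hsymm : ∀ p q, z p q = z q p)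
    (hS : ∀ p q, z p q ≠ 0 → squareGrid.Adj p q ∧ M.Used p q)
    (hz : ∀ p, ∑ q ∈ gridNeighbors p, z p q = 0) :
    (fun e => z (M.x e) (M.y e)) ∈ cycleSpace M.s M.t := by
  classical
  rw [mem_cycleSpace]
  intro v
  set T := Finset.univ.biUnion M.B with hT
  have hBT : M.B v ⊆ T := Finset.subset_biUnion_of_mem M.B (Finset.mem_univ v)
  have hnT : ∀ p, ∑ q ∈ T, z p q = 0 := by
    intro p
    rw [← hz p]
    have h1 : ∑ q ∈ T, z p q = ∑ q ∈ T ∪ gridNeighbors p, z p q :=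
      Finset.sum_subset Finset.subset_union_left fun q _ hq => by
        by_contra h
        exact hq (M.mem_biUnion_of_used (M.used_comm.1 (hS p q h).2))
    have h2 : ∑ q ∈ gridNeighbors p, z p q = ∑ q ∈ T ∪ gridNeighbors p, z p q :=
      Finset.sum_subset Finset.subset_union_right fun q _ hq => by
        by_contra h
        exact hq (mem_gridNeighbors.2 (hS p q h).1)
    rw [h1, h2]
  have hin : ∑ p ∈ M.B v, ∑ q ∈ M.B v, z p q = 0 := by
    rw [← Finset.sum_product']
    refine Finset.sum_involution (fun a _ => (a.2, a.1)) ?_ ?_ ?_ ?_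
    · rintro ⟨p, q⟩ _
      simp only
      rw [hsymm p q]
      exact CharTwo.add_self_eq_zero _
    · rintro ⟨p, q⟩ _ h1 h2
      simp only [Prod.mk.injEq] at h1 h2
      exact (hS p q h1).1.ne h2.2
    · rintro ⟨p, q⟩ h
      simp only [Finset.mem_product] at h ⊢
      exact h.symm
    · rintro ⟨p, q⟩ _
      rfl
  have hout : ∑ p ∈ M.B v, ∑ q ∈ T \ M.B v, z p q = 0 := by
    have h1 : ∑ p ∈ M.B v, (∑ q ∈ T \ M.B v, z p q + ∑ q ∈ M.B v, z p q) = 0 :=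
      Finset.sum_eq_zero fun p _ => by rw [Finset.sum_sdiff hBT, hnT]
    rwa [Finset.sum_add_distrib, hin, add_zero] at h1
  have hdec : ∀ p ∈ M.B v, ∀ q ∈ T \ M.B v, z p q = ∑ e, z (M.x e) (M.y e) *
      ((if p = M.x e ∧ q = M.y e then 1 else 0) + (if p = M.y e ∧ q = M.x e then 1 else 0)) := by
    intro p hp q hq
    by_cases h0 : z p q = 0
    · rw [h0, eq_comm]
      refine Finset.sum_eq_zero fun e _ => ?_
      by_cases h1 : p = M.x e ∧ q = M.y e
      · rw [← h1.1, ← h1.2, h0, zero_mul]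
      by_cases h2 : p = M.y e ∧ q = M.x e
      · rw [← h2.1, ← h2.2, hsymm, h0, zero_mul]
      simp [h1, h2]
    obtain ⟨w, hpw, hqw⟩ | ⟨e, he⟩ := (hS p q h0).2
    · obtain rfl := M.eq_of_mem hp hpw
      exact absurd hqw (Finset.mem_sdiff.1 hq).2
    -- The branch sets of `p` and `q` determine the ends of the edge, and `eq_of_ends` excludes
    -- parallel edges.
    have hinj : ∀ f, (p = M.x f ∧ q = M.y f) ∨ (p = M.y f ∧ q = M.x f) → e = f := by
      intro f hf
      apply M.eq_of_ends
      have hxe := M.x_mem e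
      have hye := M.y_mem e
      have hxf := M.x_mem f
      have hyf := M.y_mem f
      rcases he with ⟨he1, he2⟩ | ⟨he1, he2⟩ <;> rcases hf with ⟨hf1, hf2⟩ | ⟨hf1, hf2⟩ <;>
      have h1 := he1.symm.trans hf1 <;> have h2 := he2.symm.trans hf2
      · rw [h1] at hxe
        rw [h2] at hye
        exact Or.inl ⟨M.eq_of_mem hxe hxf, M.eq_of_mem hye hyf⟩
      · rw [h1] at hxe
        rw [h2] at hye
        exact Or.inr ⟨M.eq_of_mem hxe hyf, M.eq_of_mem hye hxf⟩
      · rw [h1] at hye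
        rw [h2] at hxe
        exact Or.inr ⟨M.eq_of_mem hxe hyf, M.eq_of_mem hye hxf⟩
      · rw [h1] at hye
        rw [h2] at hxe
        exact Or.inl ⟨M.eq_of_mem hxe hxf, M.eq_of_mem hye hyf⟩
    rw [Finset.sum_eq_single e]
    · have hne := (M.adj e).ne
      rcases he with ⟨rfl, rfl⟩ | ⟨rfl, rfl⟩
      · simp [hne]
      · simp [hne.symm, hsymm (M.y e)]
    · intro f _ hf
      have h1 : ¬ (p = M.x f ∧ q = M.y f) := fun h => hf (hinj f (Or.inl h)).symm
      have h2 : ¬ (p = M.y f ∧ q = M.x f) := fun h => hf (hinj f (Or.inr h)).symm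
      simp [h1, h2]
    · simp
  have hind : ∀ (A C : Finset (ℤ × ℤ)) (a b : ℤ × ℤ),
      ∑ p ∈ A, ∑ q ∈ C, (if p = a ∧ q = b then (1 : ZMod 2) else 0) =
        if a ∈ A ∧ b ∈ C then 1 else 0 := by
    intro A C a b
    simp only [ite_and, Finset.sum_ite_eq', Finset.sum_const_zero, Finset.sum_ite_irrel]
  have hmem : ∀ {p u w}, p ∈ M.B u → u ≠ w → (p ∈ M.B w ↔ False) ∧ (p ∈ T ↔ True) := by
    intro p u w hp huw
    simp only [iff_false, iff_true, hT, Finset.mem_biUnion, Finset.mem_univ, true_and]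
    exact ⟨fun h => huw (M.eq_of_mem hp h), u, hp⟩
  rw [Finset.sum_congr rfl fun p hp => Finset.sum_congr rfl fun q hq => hdec p hp q hq,
    Finset.sum_congr rfl fun p hp => Finset.sum_comm, Finset.sum_comm] at hout
  refine Eq.trans (Finset.sum_congr rfl fun e _ => ?_) hout
  simp only [← Finset.mul_sum, Finset.sum_add_distrib]
  rw [hind, hind]
  have hxe := M.x_mem e
  have hye := M.y_mem e
  have hst := M.s_ne_t e
  congr 2
  · by_cases h : M.s e = v
    · subst h
      simp [hxe, hmem hye hst.symm]
    · simp [h, hmem hxe h]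
  · by_cases h : M.t e = v
    · subst h
      simp [hye, hmem hxe hst]
    · simp [h, hmem hye h]

/-- The chain is the sum of three: from one root to `x e` inside its branch set, across the grid
edge of `e`, and from `y e` to the other root. Only the middle part uses a grid edge between
different branch sets. -/
theorem exists_edge_chain [DecidableEq E] (root : V → ℤ × ℤ) (hroot : ∀ v, root v ∈ M.B v)
    (e : E) :
    ∃ z : ℤ × ℤ → ℤ × ℤ → ZMod 2, (∀ p q, z p q = z q p) ∧
      (∀ p q, z p q ≠ 0 → squareGrid.Adj p q ∧ M.Used p q) ∧
      (∀ p, ∑ q ∈ gridNeighbors p, z p q =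
        (if root (M.s e) = p then 1 else 0) + (if root (M.t e) = p then 1 else 0)) ∧
      ∀ f, z (M.x f) (M.y f) = if e = f then 1 else 0 := by
  obtain ⟨z₁, hs₁, hB₁, hz₁⟩ := exists_chain_of_reachable _
    ((M.connected (M.s e)).preconnected ⟨root (M.s e), hroot _⟩ ⟨M.x e, M.x_mem e⟩)
  obtain ⟨z₂, hs₂, hB₂, hz₂⟩ := exists_chain_of_reachable {p | p = M.x e ∨ p = M.y e}
    (x := ⟨M.x e, Or.inl rfl⟩) (y := ⟨M.y e, Or.inr rfl⟩)
    (SimpleGraph.Adj.reachable (M.adj e))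
  obtain ⟨z₃, hs₃, hB₃, hz₃⟩ := exists_chain_of_reachable _
    ((M.connected (M.t e)).preconnected ⟨M.y e, M.y_mem e⟩ ⟨root (M.t e), hroot _⟩)
  have hnot : ∀ f v, ¬ (M.x f ∈ M.B v ∧ M.y f ∈ M.B v) := fun f v h =>
    M.s_ne_t f ((M.eq_of_mem (M.x_mem f) h.1).trans (M.eq_of_mem h.2 (M.y_mem f)))
  have h₁ : ∀ f, z₁ (M.x f) (M.y f) = 0 := fun f => by
    by_contra h
    exact hnot f _ (hB₁ _ _ h).2
  have h₃ : ∀ f, z₃ (M.x f) (M.y f) = 0 := fun f => by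
    by_contra h
    exact hnot f _ (hB₃ _ _ h).2
  have hne := (M.adj e).ne
  have two : (2 : ZMod 2) = 0 := rfl
  have h₂e : z₂ (M.x e) (M.y e) = 1 := by
    have := hz₂ (M.x e)
    rw [Finset.sum_eq_single (M.y e)] at this
    · simpa [hne.symm] using this
    · intro q _ hq
      by_contra h
      obtain ⟨hadj, -, h1 | h1⟩ := hB₂ _ _ h
      · exact hadj.ne h1.symm
      · exact hq h1
    · intro h
      exact absurd (mem_gridNeighbors.2 (M.adj e)) h
  refine ⟨fun p q => z₁ p q + z₂ p q + z₃ p q, fun p q => ?_, fun p q h => ?_, fun p => ?_,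
    fun f => ?_⟩
  · simp only [hs₁ p q, hs₂ p q, hs₃ p q]
  · by_cases h1 : z₁ p q = 0
    · by_cases h2 : z₂ p q = 0
      · by_cases h3 : z₃ p q = 0
        · simp [h1, h2, h3] at h
        · exact ⟨(hB₃ _ _ h3).1, Or.inl ⟨_, (hB₃ _ _ h3).2⟩⟩
      · obtain ⟨hadj, hp, hq⟩ := hB₂ _ _ h2
        refine ⟨hadj, Or.inr ⟨e, ?_⟩⟩
        rcases hp with rfl | rfl <;> rcases hq with rfl | rfl
        · exact absurd rfl hadj.ne
        · simp
        · simp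
        · exact absurd rfl hadj.ne
    · exact ⟨(hB₁ _ _ h1).1, Or.inl ⟨_, (hB₁ _ _ h1).2⟩⟩
  · rw [Finset.sum_add_distrib, Finset.sum_add_distrib, hz₁, hz₂, hz₃]
    linear_combination ((if M.x e = p then (1 : ZMod 2) else 0) +
      (if M.y e = p then (1 : ZMod 2) else 0)) * two
  · simp only [h₁, h₃, zero_add, add_zero]
    by_cases hef : e = f
    · rw [← hef, h₂e, if_pos rfl]
    · rw [if_neg hef]
      by_contra h
      obtain ⟨hadj, hp, hq⟩ := hB₂ _ _ h
      apply hef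
      apply M.eq_of_ends
      have hxe := M.x_mem e
      have hye := M.y_mem e
      have hxf := M.x_mem f
      have hyf := M.y_mem f
      rcases hp with hp | hp <;> rcases hq with hq | hq
      · exact absurd (hp.trans hq.symm) hadj.ne
      · rw [hp] at hxf
        rw [hq] at hyf
        exact Or.inl ⟨M.eq_of_mem hxe hxf, M.eq_of_mem hye hyf⟩
      · rw [hp] at hxf
        rw [hq] at hyf
        exact Or.inr ⟨M.eq_of_mem hxe hyf, M.eq_of_mem hye hxf⟩
      · exact absurd (hp.trans hq.symm) hadj.ne

/-- Adding the edge chains with coefficients `c` moves the boundary of `c` to the roots, where it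
vanishes. -/
theorem exists_cycle_of_mem_cycleSpace [Fintype V] [DecidableEq V] [Fintype E]
    {c : E → ZMod 2} (hc : c ∈ cycleSpace M.s M.t) :
    ∃ z : ℤ × ℤ → ℤ × ℤ → ZMod 2, (∀ p q, z p q = z q p) ∧
      (∀ p q, z p q ≠ 0 → squareGrid.Adj p q ∧ M.Used p q) ∧
      (∀ p, ∑ q ∈ gridNeighbors p, z p q = 0) ∧ ∀ e, z (M.x e) (M.y e) = c e := by
  classical
  have hroot : ∀ v, ∃ p, p ∈ M.B v := fun v => by
    obtain ⟨p, hp⟩ := (M.connected v).nonempty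
    exact ⟨p, hp⟩
  choose root hroot using hroot
  choose z hs hU hz hx using M.exists_edge_chain root hroot
  refine ⟨fun p q => ∑ e, c e * z e p q, fun p q => ?_, fun p q h => ?_, fun p => ?_,
    fun f => ?_⟩
  · exact Finset.sum_congr rfl fun e _ => by rw [hs]
  · obtain ⟨e, -, he⟩ := Finset.exists_ne_zero_of_sum_ne_zero h
    exact hU e p q (right_ne_zero_of_mul he)
  · rw [Finset.sum_comm]
    simp only [← Finset.mul_sum, hz]
    rw [mem_cycleSpace] at hc
    have key : ∀ u, (if root u = p then (1 : ZMod 2) else 0) =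
        ∑ v, (if root v = p then 1 else 0) * (if u = v then 1 else 0) := by simp
    have hexp : ∀ e, c e * ((if root (M.s e) = p then 1 else 0) +
        (if root (M.t e) = p then 1 else 0)) = ∑ v, (if root v = p then 1 else 0) *
          (c e * ((if M.s e = v then 1 else 0) + (if M.t e = v then 1 else 0))) := by
      intro e
      rw [key (M.s e), key (M.t e), ← Finset.sum_add_distrib, Finset.mul_sum]
      exact Finset.sum_congr rfl fun v _ => by ring
    rw [Finset.sum_congr rfl fun e _ => hexp e, Finset.sum_comm]
    refine Finset.sum_eq_zero fun v _ => ?_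
    rw [← Finset.mul_sum, hc v, mul_zero]
  · simp [hx]

/-- Euler's inequality for minors of the grid: the dimension of the cycle space, in terms of the
least size of a cycle. -/
theorem mul_finrank_cycleSpace_add_one_le [Fintype V] [DecidableEq V] [Fintype E] (g : ℕ)
    (hg : ∀ c ∈ cycleSpace M.s M.t, c ≠ 0 → g ≤ (Finset.univ.filter (fun e => c e ≠ 0)).card)
    (hZ : cycleSpace M.s M.t ≠ ⊥) :
    g * (Module.finrank (ZMod 2) (cycleSpace M.s M.t) + 1) ≤ 2 * Fintype.card E := by
  classical
  -- The faces are the classes of unit squares glued across unused grid edges.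
  set rel : ℤ × ℤ → ℤ × ℤ → Prop := fun a b => ∃ p q, squareGrid.Adj p q ∧ ¬ M.Used p q ∧
    a = upperSquare p q ∧ b = lowerSquare p q with hrel
  refine mul_finrank_add_one_le_of_faces (Φ := Quot rel) (cycleSpace M.s M.t)
    (fun e => Quot.mk _ (upperSquare (M.x e) (M.y e)))
    (fun e => Quot.mk _ (lowerSquare (M.x e) (M.y e))) (fun f => ?_) (fun c hc => ?_) g hg hZ
  · set h : ℤ × ℤ → ZMod 2 := fun a => if Quot.mk rel a = f then 1 else 0 with hh
    have h0 : ∀ p q, squareGrid.Adj p q → ¬ M.Used p q →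
        h (upperSquare p q) + h (lowerSquare p q) = 0 := by
      intro p q hpq hU
      have : Quot.mk rel (upperSquare p q) = Quot.mk rel (lowerSquare p q) :=
        Quot.sound ⟨p, q, hpq, hU, rfl, rfl⟩
      simp only [hh, this]
      exact CharTwo.add_self_eq_zero _
    have := M.mem_cycleSpace_of_cycle (fun p q => if squareGrid.Adj p q then
      h (upperSquare p q) + h (lowerSquare p q) else 0) (fun p q => ?_) (fun p q hpq => ?_)
      (fun p => ?_)
    · convert this using 2 with e
      rw [if_pos (M.adj e)]
    · simp only [upperSquare_comm p q, lowerSquare_comm p q, squareGrid.adj_comm p q]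
    · rw [ite_ne_right_iff] at hpq
      refine ⟨hpq.1, ?_⟩
      by_contra hU
      exact hpq.2 (h0 p q hpq.1 hU)
    · rw [← sum_gridNeighbors_squares_eq_zero h p]
      exact Finset.sum_congr rfl fun q hq => if_pos (mem_gridNeighbors.1 hq)
  · obtain ⟨z, hs, hU, hz, hx⟩ := M.exists_cycle_of_mem_cycleSpace hc
    obtain ⟨H, hH⟩ := exists_eq_squares_of_cycle z hs (Finset.univ.biUnion M.B)
      (fun p q h => M.mem_biUnion_of_used (hU p q h).2) hz
    -- The lifted cycle vanishes on unused grid edges, so `H` does not change across them and is a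
    -- function of the face.
    have hconst : ∀ a b, rel a b → H a = H b := by
      rintro _ _ ⟨p, q, hpq, hnU, rfl, rfl⟩
      have : z p q = 0 := by
        by_contra h
        exact hnU (hU p q h).2
      rw [hH p q hpq] at this
      exact CharTwo.add_eq_zero.1 this
    exact ⟨Quot.lift H hconst, fun e => by rw [← hx e, hH _ _ (M.adj e)]⟩

end GridModel

/-! ### The edge bound for triangle-free grid minors -/

/-- A graph is a minor of the square grid, with finite branch sets. -/
def SimpleGraph.IsGridMinor {V : Type*} (G : SimpleGraph V) : Prop :=
  ∃ B : V → Finset (ℤ × ℤ), (∀ p u v, p ∈ B u → p ∈ B v → u = v) ∧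
    (∀ v, (squareGrid.induce (B v : Set (ℤ × ℤ))).Connected) ∧
    ∀ u v, G.Adj u v → ∃ x ∈ B u, ∃ y ∈ B v, squareGrid.Adj x y

/-- A triangle-free minor of the grid with `n ≥ 3` vertices has at most `2n - 4` edges. -/
theorem SimpleGraph.IsGridMinor.card_edgeSet_add_four_le {V : Type*} [Fintype V]
    {G : SimpleGraph V} [Fintype G.edgeSet] (hG : G.IsGridMinor)
    (h3 : ∀ a b c, G.Adj a b → G.Adj b c → G.Adj c a → False) (hn : 3 ≤ Fintype.card V) :
    Fintype.card G.edgeSet + 4 ≤ 2 * Fintype.card V := by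
  classical
  obtain ⟨B, hdisj, hconn, hadj⟩ := hG
  have hE : ∀ e : G.edgeSet, ∃ u v x y, (e : Sym2 V) = s(u, v) ∧ u ≠ v ∧ x ∈ B u ∧ y ∈ B v ∧
      squareGrid.Adj x y := by
    rintro ⟨e, he⟩
    induction e with
    | h u v =>
      obtain ⟨x, hx, y, hy, hxy⟩ := hadj u v he
      exact ⟨u, v, x, y, rfl, G.ne_of_adj he, hx, hy, hxy⟩
  choose s t x y hst hne hx hy hxy using hE
  set M : GridModel V G.edgeSet := ⟨B, s, t, x, y, fun h h' => hdisj _ _ _ h h', hconn, hx, hy,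
    hxy, hne, fun e f h => Subtype.ext (by rw [hst, hst, Sym2.eq_iff]; exact h)⟩
  have hdim := (haveI : Nonempty V := Fintype.card_pos_iff.1 (by omega)
    card_add_one_le_finrank_cycleSpace M.s M.t)
  -- With no cycles, `|E| ≤ |V| - 1`, which suffices because `|V| ≥ 3`. Otherwise `4 (|E| - |V| + 2)
  -- ≤ 2 |E|`.
  by_cases hZ : cycleSpace M.s M.t = ⊥
  · rw [hZ, finrank_bot] at hdim
    omega
  · have := M.mul_finrank_cycleSpace_add_one_le 4
      (fun c hc h0 => four_le_card_support_of_mem_cycleSpace h3 hst hc h0) hZ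
    omega

/-! ### Grid paths and a criterion for grid minors -/

/-- The points `a` and `b` are joined by a grid path inside `N`. -/
def GridJoined (N : Set (ℤ × ℤ)) : ℤ × ℤ → ℤ × ℤ → Prop :=
  Relation.ReflTransGen fun p q => p ∈ N ∧ q ∈ N ∧ squareGrid.Adj p q

namespace GridJoined

variable {N : Set (ℤ × ℤ)} {a b c : ℤ × ℤ}

theorem single (ha : a ∈ N) (hb : b ∈ N) (h : squareGrid.Adj a b) : GridJoined N a b :=
  Relation.ReflTransGen.single ⟨ha, hb, h⟩

theorem trans (h : GridJoined N a b) (h' : GridJoined N b c) : GridJoined N a c :=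
  Relation.ReflTransGen.trans h h'

theorem symm (h : GridJoined N a b) : GridJoined N b a := by
  induction h with
  | refl => exact .refl
  | tail _ h ih => exact (single h.2.1 h.1 h.2.2.symm).trans ih

theorem mono {N' : Set (ℤ × ℤ)} (hN : N ⊆ N') (h : GridJoined N a b) : GridJoined N' a b :=
  Relation.ReflTransGen.mono (fun _ _ h => ⟨hN h.1, hN h.2.1, h.2.2⟩) _ _ h

theorem mem (h : GridJoined N a b) (ha : a ∈ N) : b ∈ N := by
  cases h with
  | refl => exact ha
  | tail _ h => exact h.2.1

/-- Every prefix of a path stays in the component; this makes the component connected within itself,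
as a branch set must be. -/
theorem in_component (h : GridJoined N a b) : GridJoined {x | GridJoined N a x} a b := by
  induction h with
  | refl => exact .refl
  | tail hab h ih => exact ih.trans (single hab (hab.trans (single h.1 h.2.1 h.2.2)) h.2.2)

theorem reachable (h : GridJoined N a b) (ha : a ∈ N) (hb : b ∈ N) :
    (squareGrid.induce N).Reachable ⟨a, ha⟩ ⟨b, hb⟩ := by
  induction h with
  | refl => exact .refl _
  | tail hab h ih =>
    refine (ih h.1).trans (SimpleGraph.Adj.reachable ?_)
    exact h.2.2

/-- A path from `a` to a point of `C` has a first step into `C`. -/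
theorem exists_adj_of_mem {C : Set (ℤ × ℤ)} (h : GridJoined N a b) (ha : a ∉ C) (hb : b ∈ C) :
    ∃ x y, GridJoined (N \ C) a x ∧ y ∈ C ∧ squareGrid.Adj x y := by
  by_contra! hcon
  have : GridJoined (N \ C) a b ∧ b ∉ C := by
    clear hb
    induction h with
    | refl => exact ⟨.refl, ha⟩
    | tail _ h ih =>
      have hC := fun hc => hcon _ _ ih.1 hc h.2.2
      exact ⟨ih.1.trans (single ⟨h.1, ih.2⟩ ⟨h.2.1, hC⟩ h.2.2), hC⟩
  exact this.2 hb

theorem horizontal {i j : ℤ} (n : ℕ) (h : ∀ k : ℕ, k ≤ n → (i + k, j) ∈ N) :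
    GridJoined N (i, j) (i + n, j) := by
  induction n with
  | zero =>
    simp only [Nat.cast_zero, add_zero]
    exact .refl
  | succ n ih =>
    refine (ih fun k hk => h k (by omega)).trans (single (h n (by omega)) (h _ le_rfl) ?_)
    refine Or.inr ⟨rfl, Or.inl ?_⟩
    push_cast
    ring

theorem vertical {i j : ℤ} (n : ℕ) (h : ∀ k : ℕ, k ≤ n → (i, j + k) ∈ N) :
    GridJoined N (i, j) (i, j + n) := by
  induction n with
  | zero =>
    simp only [Nat.cast_zero, add_zero]
    exact .refl
  | succ n ih =>
    refine (ih fun k hk => h k (by omega)).trans (single (h n (by omega)) (h _ le_rfl) ?_)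
    refine Or.inl ⟨rfl, Or.inl ?_⟩
    push_cast
    ring

theorem box {I J : Set ℤ} (hI : I.OrdConnected) (hJ : J.OrdConnected) {i i' j j' : ℤ}
    (hi : i ∈ I) (hi' : i' ∈ I) (hj : j ∈ J) (hj' : j' ∈ J) :
    GridJoined (I ×ˢ J) (i, j) (i', j') := by
  have hor : ∀ {i i' j}, i ∈ I → i' ∈ I → j ∈ J → i ≤ i' →
      GridJoined (I ×ˢ J) (i, j) (i', j) := by
    intro i i' j hi hi' hj hle
    have := horizontal (N := I ×ˢ J) (i := i) (j := j) (i' - i).toNat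
      fun k hk => ⟨hI.out hi hi' ⟨by simp, by simp only; omega⟩, hj⟩
    rwa [Int.toNat_of_nonneg (by omega), add_sub_cancel] at this
  have ver : ∀ {i j j'}, i ∈ I → j ∈ J → j' ∈ J → j ≤ j' →
      GridJoined (I ×ˢ J) (i, j) (i, j') := by
    intro i j j' hi hj hj' hle
    have := vertical (N := I ×ˢ J) (i := i) (j := j) (j' - j).toNat
      fun k hk => ⟨hi, hJ.out hj hj' ⟨by simp, by simp only; omega⟩⟩
    rwa [Int.toNat_of_nonneg (by omega), add_sub_cancel] at this
  refine trans (b := (i', j)) ?_ ?_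
  · rcases le_total i i' with h | h
    · exact hor hi hi' hj h
    · exact (hor hi' hi hj h).symm
  · rcases le_total j j' with h | h
    · exact ver hi' hj hj' h
    · exact (ver hi' hj' hj h).symm

end GridJoined

/-- A criterion for being a minor of the grid: the vertices are given by disjoint connected sets
`D w`, the edges by connected sets `S e` which meet the sets of their own ends only, and which do
not meet each other outside the sets `D w`. -/
theorem SimpleGraph.isGridMinor_of_sets {V : Type*} [Finite V] (G : SimpleGraph V)
    (D : V → Set (ℤ × ℤ)) (S : Sym2 V → Set (ℤ × ℤ)) (root : V → ℤ × ℤ)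
    (hDfin : ∀ w, (D w).Finite) (hSfin : ∀ e ∈ G.edgeSet, (S e).Finite)
    (hrootD : ∀ w, root w ∈ D w) (hrootS : ∀ e ∈ G.edgeSet, ∀ w ∈ e, root w ∈ S e)
    (hD : ∀ w, ∀ x ∈ D w, GridJoined (D w) (root w) x)
    (hS : ∀ e ∈ G.edgeSet, ∀ x ∈ S e, ∀ y ∈ S e, GridJoined (S e) x y)
    (hDD : ∀ x u v, x ∈ D u → x ∈ D v → u = v)
    (hSD : ∀ e ∈ G.edgeSet, ∀ x w, x ∈ S e → x ∈ D w → w ∈ e)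
    (hSS : ∀ e ∈ G.edgeSet, ∀ f ∈ G.edgeSet, e ≠ f → ∀ x, x ∈ S e → x ∈ S f → ∃ w, x ∈ D w) :
    G.IsGridMinor := by
  classical
  have hsplit : ∀ e : Sym2 V, ∃ u v, e = s(u, v) := fun e => by
    induction e with | h u v => exact ⟨u, v, rfl⟩
  choose tl hd hth using hsplit
  have htl : ∀ e, tl e ∈ e := fun e => by
    have := Sym2.mem_mk_left (tl e) (hd e)
    rwa [← hth e] at this
  have hhd : ∀ e, hd e ∈ e := fun e => by
    have := Sym2.mem_mk_right (tl e) (hd e)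
    rwa [← hth e] at this
  have hne : ∀ e ∈ G.edgeSet, tl e ≠ hd e := fun e he => by
    rw [hth e] at he
    exact G.ne_of_adj he
  have hmem : ∀ e w, w ∈ e → w = tl e ∨ w = hd e := fun e w hw => by
    rw [hth e] at hw
    exact Sym2.mem_iff.1 hw
  -- The branch set of a vertex absorbs, for each edge that starts there, the part of `S e`
  -- reachable from the tail before `D (hd e)` is entered. The first step into `D (hd e)` represents
  -- the edge.
  set T : Sym2 V → Set (ℤ × ℤ) := fun e => {x | GridJoined (S e \ D (hd e)) (root (tl e)) x}
    with hT
  have hTS : ∀ e ∈ G.edgeSet, ∀ x ∈ T e, x ∈ S e ∧ x ∉ D (hd e) := fun e he x hx =>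
    GridJoined.mem hx ⟨hrootS e he _ (htl e), fun h => hne e he (hDD _ _ _ (hrootD _) h)⟩
  set B : V → Set (ℤ × ℤ) := fun u => D u ∪ ⋃ e ∈ {e | e ∈ G.edgeSet ∧ tl e = u}, T e with hB
  have hBmem : ∀ x u, x ∈ B u ↔ x ∈ D u ∨ ∃ e, (e ∈ G.edgeSet ∧ tl e = u) ∧ x ∈ T e := by
    intro x u
    simp only [hB, Set.mem_union, Set.mem_iUnion, exists_prop, Set.mem_ofPred_eq]
  have hBfin : ∀ u, (B u).Finite := fun u =>
    (hDfin u).union ((Set.toFinite _).biUnion fun e he =>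
      (hSfin e he.1).subset fun x hx => (hTS e he.1 x hx).1)
  have hTD : ∀ e ∈ G.edgeSet, ∀ x ∈ T e, ∀ w, x ∈ D w → w = tl e := fun e he x hx w hw =>
    (hmem e w (hSD e he x w (hTS e he x hx).1 hw)).resolve_right
      fun h => (hTS e he x hx).2 (h ▸ hw)
  refine ⟨fun u => (hBfin u).toFinset, fun x u v hu hv => ?_, fun u => ?_, fun u v huv => ?_⟩
  · rw [Set.Finite.mem_toFinset, hBmem] at hu hv
    rcases hu with hu | ⟨e, ⟨he, rfl⟩, hu⟩ <;> rcases hv with hv | ⟨f, ⟨hf, rfl⟩, hv⟩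
    · exact hDD x u v hu hv
    · exact hTD f hf x hv u hu
    · exact (hTD e he x hu v hv).symm
    · by_cases hef : e = f
      · rw [hef]
      -- Two such parts meet only in some `D w`, and then `w` is the tail of both edges.
      obtain ⟨w, hw⟩ := hSS e he f hf hef x (hTS e he x hu).1 (hTS f hf x hv).1
      rw [← hTD e he x hu w hw, ← hTD f hf x hv w hw]
  · rw [Set.Finite.coe_toFinset]
    have hroot : root u ∈ B u := (hBmem _ _).2 (Or.inl (hrootD u))
    have hj : ∀ x ∈ B u, GridJoined (B u) (root u) x := by
      intro x hx
      rw [hBmem] at hx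
      rcases hx with hx | ⟨e, ⟨he, rfl⟩, hx⟩
      · exact (hD u x hx).mono fun y hy => (hBmem y u).2 (Or.inl hy)
      · exact (GridJoined.in_component hx).mono fun y hy =>
          (hBmem y _).2 (Or.inr ⟨e, ⟨he, rfl⟩, hy⟩)
    have : Nonempty (B u) := ⟨⟨_, hroot⟩⟩
    exact ⟨fun x y => ((hj x x.2).symm.trans (hj y y.2)).reachable x.2 y.2⟩
  · have key : ∀ e ∈ G.edgeSet, ∃ x ∈ B (tl e), ∃ y ∈ B (hd e), squareGrid.Adj x y := by
      intro e he
      obtain ⟨x, y, hx, hy, hxy⟩ := (hS e he _ (hrootS e he _ (htl e)) _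
        (hrootS e he _ (hhd e))).exists_adj_of_mem
        (fun h => hne e he (hDD _ _ _ (hrootD _) h)) (hrootD (hd e))
      exact ⟨x, (hBmem _ _).2 (Or.inr ⟨e, ⟨he, rfl⟩, hx⟩), y, (hBmem _ _).2 (Or.inl hy), hxy⟩
    obtain ⟨x, hx, y, hy, hxy⟩ := key s(u, v) huv
    simp only [Set.Finite.mem_toFinset]
    rcases Sym2.eq_iff.1 (hth s(u, v)) with ⟨h1, h2⟩ | ⟨h1, h2⟩
    · rw [← h1] at hx
      rw [← h2] at hy
      exact ⟨x, hx, y, hy, hxy⟩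
    · rw [← h2] at hx
      rw [← h1] at hy
      exact ⟨y, hy, x, hx, hxy.symm⟩

/-! ### Discretising a plane drawing -/

/-- The points of the grid of mesh `1 / R` that are close to the plane set `K`. -/
def gridNbhd (R : ℝ) (K : Set (EuclideanSpace ℝ (Fin 2))) : Set (ℤ × ℤ) :=
  {x | ∃ y ∈ K, |(x.1 : ℝ) - R * y 0| ≤ 1 ∧ |(x.2 : ℝ) - R * y 1| ≤ 1}

theorem abs_coord_sub_le (y z : EuclideanSpace ℝ (Fin 2)) (i : Fin 2) :
    |y i - z i| ≤ dist y z := by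
  rw [dist_eq_norm]
  exact PiLp.norm_apply_le (y - z) i

theorem dist_le_abs_add_abs (y z : EuclideanSpace ℝ (Fin 2)) :
    dist y z ≤ |y 0 - z 0| + |y 1 - z 1| := by
  rw [EuclideanSpace.dist_eq, Fin.sum_univ_two, Real.dist_eq, Real.dist_eq]
  apply Real.sqrt_le_iff.2
  refine ⟨by positivity, ?_⟩
  nlinarith [abs_nonneg (y 0 - z 0), abs_nonneg (y 1 - z 1),
    mul_nonneg (abs_nonneg (y 0 - z 0)) (abs_nonneg (y 1 - z 1))]

theorem round_mem_gridNbhd {R : ℝ} {K : Set (EuclideanSpace ℝ (Fin 2))}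
    {y : EuclideanSpace ℝ (Fin 2)} (hy : y ∈ K) :
    (round (R * y 0), round (R * y 1)) ∈ gridNbhd R K := by
  refine ⟨y, hy, ?_, ?_⟩ <;> rw [abs_sub_comm] <;> exact (abs_sub_round _).trans (by norm_num)

theorem finite_gridNbhd (R : ℝ) {K : Set (EuclideanSpace ℝ (Fin 2))}
    (hK : Bornology.IsBounded K) : (gridNbhd R K).Finite := by
  obtain ⟨C, hC⟩ := hK.exists_norm_le
  set n : ℤ := ⌈|R| * C + 1⌉ with hn
  refine ((Set.finite_Icc (-n) n).prod (Set.finite_Icc (-n) n)).subset ?_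
  rintro x ⟨y, hy, h0, h1⟩
  have key : ∀ (m : ℤ) (i : Fin 2), |(m : ℝ) - R * y i| ≤ 1 → m ∈ Set.Icc (-n) n := by
    intro m i hm
    have h2 : |y i| ≤ C := (PiLp.norm_apply_le y i).trans (hC y hy)
    have h3 : |R * y i| ≤ |R| * C := by
      rw [abs_mul]
      exact mul_le_mul_of_nonneg_left h2 (abs_nonneg R)
    have h4 : |R| * C + 1 ≤ n := Int.le_ceil _
    rw [abs_le] at hm h3
    constructor
    · have : -(n : ℝ) ≤ m := by linarith
      exact_mod_cast this
    · have : (m : ℝ) ≤ n := by linarith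
      exact_mod_cast this
  exact ⟨key _ _ h0, key _ _ h1⟩

/-- The grid points near a single point form a box, hence are joined, and sufficiently close points
of `K` share a nearby grid point. Preconnectedness propagates this local statement. -/
theorem gridJoined_gridNbhd {R : ℝ} (hR : 0 < R) {K : Set (EuclideanSpace ℝ (Fin 2))}
    (hK : IsPreconnected K) {x x' : ℤ × ℤ} (hx : x ∈ gridNbhd R K) (hx' : x' ∈ gridNbhd R K) :
    GridJoined (gridNbhd R K) x x' := by
  have hpt : ∀ y ∈ K, ∀ x ∈ gridNbhd R {y}, ∀ x' ∈ gridNbhd R {y},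
      GridJoined (gridNbhd R K) x x' := by
    rintro y hy ⟨i, j⟩ ⟨_, rfl, h0, h1⟩ ⟨i', j'⟩ ⟨_, rfl, h0', h1'⟩
    have hord : ∀ a : ℝ, ({m : ℤ | |(m : ℝ) - a| ≤ 1}).OrdConnected := fun a => by
      refine ⟨fun m hm n hn k hk => ?_⟩
      have h1 : (m : ℝ) ≤ k := by exact_mod_cast hk.1
      have h2 : (k : ℝ) ≤ n := by exact_mod_cast hk.2
      simp only [Set.mem_ofPred_eq, abs_le] at hm hn ⊢
      constructor <;> linarith [hm.1, hm.2, hn.1, hn.2]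
    refine (GridJoined.box (hord _) (hord _) h0 h0' h1 h1').mono ?_
    rintro ⟨k, l⟩ ⟨hk, hl⟩
    exact ⟨_, hy, hk, hl⟩
  obtain ⟨y, hy, hxy⟩ := hx
  obtain ⟨y', hy', hxy'⟩ := hx'
  have key := hK.induction₂ (fun y y' => ∀ x ∈ gridNbhd R {y}, ∀ x' ∈ gridNbhd R {y'},
    GridJoined (gridNbhd R K) x x') ?_ ?_ ?_ hy hy'
  · exact key x ⟨y, rfl, hxy⟩ x' ⟨y', rfl, hxy'⟩
  · intro y hy
    -- After scaling by `R`, rounding costs at most `1 / 2` per coordinate and this radius another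
    -- `1 / 2`, within the allowed `1`.
    have hball : Metric.ball y (1 / (2 * R)) ∈ nhdsWithin y K :=
      mem_nhdsWithin_of_mem_nhds (Metric.ball_mem_nhds y (by positivity))
    filter_upwards [hball, self_mem_nhdsWithin] with y' hyy' hy'
    intro x hx x' hx'
    have hmid : (round (R * y 0), round (R * y 1)) ∈ gridNbhd R {y'} := by
      have key : ∀ i, |(round (R * y i) : ℝ) - R * y' i| ≤ 1 := by
        intro i
        have h1 := abs_sub_round (R * y i)
        have h2 : |y i - y' i| ≤ 1 / (2 * R) :=
          (abs_coord_sub_le y y' i).trans (by rw [dist_comm]; exact (Metric.mem_ball.1 hyy').le)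
        have h3 : |R * y i - R * y' i| ≤ 1 / 2 := by
          rw [← mul_sub, abs_mul, abs_of_pos hR]
          calc R * |y i - y' i| ≤ R * (1 / (2 * R)) := mul_le_mul_of_nonneg_left h2 hR.le
            _ = 1 / 2 := by field_simp
        rw [abs_le] at h1 h3 ⊢
        constructor <;> linarith [h1.1, h1.2, h3.1, h3.2]
      exact ⟨y', rfl, key 0, key 1⟩
    exact (hpt y hy x hx _ (round_mem_gridNbhd rfl)).trans (hpt y' hy' _ hmid x' hx')
  · intro y z w _ hz _ h1 h2 x hx x' hx'
    exact (h1 x hx _ (round_mem_gridNbhd rfl)).trans (h2 _ (round_mem_gridNbhd rfl) x' hx')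
  · exact fun y y' _ _ h x hx x' hx' => (h x' hx' x hx).symm

open Filter Topology

theorem eventually_disjoint_gridNbhd {K L : Set (EuclideanSpace ℝ (Fin 2))} (hK : IsCompact K)
    (hL : IsCompact L) (hKL : Disjoint K L) :
    ∀ᶠ R : ℝ in atTop, ∀ x, x ∈ gridNbhd R K → x ∉ gridNbhd R L := by
  obtain ⟨r, hr, h⟩ := Metric.exists_pos_forall_lt_edist hK hL.isClosed hKL
  have hr' : (0 : ℝ) < r := hr
  -- A common grid point bounds each coordinate difference by `2 / R`, hence the distance by `4 /
  -- R`, which must fall below the gap `r`.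
  filter_upwards [eventually_gt_atTop (4 / (r : ℝ)), eventually_gt_atTop 0] with R hR hR0
  rintro x ⟨y, hy, h0, h1⟩ ⟨z, hz, h0', h1'⟩
  have key : ∀ (m : ℤ) (i : Fin 2), |(m : ℝ) - R * y i| ≤ 1 → |(m : ℝ) - R * z i| ≤ 1 →
      R * |y i - z i| ≤ 2 := by
    intro m i hm hm'
    have : R * |y i - z i| = |R * y i - R * z i| := by rw [← mul_sub, abs_mul, abs_of_pos hR0]
    rw [this]
    rw [abs_le] at hm hm' ⊢
    constructor <;> linarith [hm.1, hm.2, hm'.1, hm'.2]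
  have hd := dist_le_abs_add_abs y z
  have hlt : (r : ℝ) < dist y z := by
    have := h y hy z hz
    rw [edist_nndist] at this
    exact_mod_cast this
  have h4 : 4 < R * r := by
    rwa [div_lt_iff₀ hr'] at hR
  have h5 : R * r < R * dist y z := mul_lt_mul_of_pos_left hlt hR0
  have h6 : R * dist y z ≤ R * (|y 0 - z 0| + |y 1 - z 1|) := mul_le_mul_of_nonneg_left hd hR0.le
  linarith [key _ _ h0 h0', key _ _ h1 h1']

theorem eventually_disjoint_closedBall {X : Type*} [MetricSpace X] {K : Set X} (hK : IsClosed K)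
    {q : X} (hq : q ∉ K) : ∀ᶠ r : ℝ in 𝓝[>] 0, Disjoint (Metric.closedBall q r) K := by
  obtain ⟨ε, hε, h⟩ := Metric.isOpen_iff.1 hK.isOpen_compl q hq
  filter_upwards [Ioo_mem_nhdsGT hε] with r hr
  exact Set.disjoint_left.2 fun x hx => h (Metric.closedBall_subset_ball hr.2 hx)

theorem IsPlaneArc.isCompact {a b : EuclideanSpace ℝ (Fin 2)}
    {S : Set (EuclideanSpace ℝ (Fin 2))} (h : IsPlaneArc a b S) : IsCompact S := by
  obtain ⟨γ, -, rfl⟩ := h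
  exact isCompact_range γ.continuous

theorem IsPlaneArc.isPreconnected {a b : EuclideanSpace ℝ (Fin 2)}
    {S : Set (EuclideanSpace ℝ (Fin 2))} (h : IsPlaneArc a b S) : IsPreconnected S := by
  obtain ⟨γ, -, rfl⟩ := h
  exact isPreconnected_range γ.continuous

theorem IsPlaneArc.left_mem {a b : EuclideanSpace ℝ (Fin 2)}
    {S : Set (EuclideanSpace ℝ (Fin 2))} (h : IsPlaneArc a b S) : a ∈ S := by
  obtain ⟨γ, -, rfl⟩ := h
  exact ⟨0, γ.source⟩

theorem IsPlaneArc.right_mem {a b : EuclideanSpace ℝ (Fin 2)}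
    {S : Set (EuclideanSpace ℝ (Fin 2))} (h : IsPlaneArc a b S) : b ∈ S := by
  obtain ⟨γ, -, rfl⟩ := h
  exact ⟨1, γ.target⟩

/-- A finite planar graph is a minor of the square grid. -/
theorem SimpleGraph.IsPlanarGraph.isGridMinor {V : Type*} [Finite V] {G : SimpleGraph V}
    (hG : G.IsPlanarGraph) : G.IsGridMinor := by
  obtain ⟨p, A, hp, harc, hvert, hcross⟩ := hG
  have hcpt : ∀ e ∈ G.edgeSet, IsCompact (A e) := fun e he => by
    induction e with | h u v => exact (harc u v he).isCompact
  have hconn : ∀ e ∈ G.edgeSet, IsPreconnected (A e) := fun e he => by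
    induction e with | h u v => exact (harc u v he).isPreconnected
  have hend : ∀ e ∈ G.edgeSet, ∀ w ∈ e, p w ∈ A e := fun e he w hw => by
    induction e with | h u v =>
    rcases Sym2.mem_iff.1 hw with rfl | rfl
    · exact (harc _ _ he).left_mem
    · exact (harc _ _ he).right_mem
  -- Discs around the vertices, so small that they are disjoint and miss the arcs not incident with
  -- them.
  obtain ⟨r, hr, hr1, hr2⟩ : ∃ r : ℝ, 0 < r ∧
      (∀ u v, u ≠ v → Disjoint (Metric.closedBall (p u) r) (Metric.closedBall (p v) r)) ∧
      ∀ w e, e ∈ G.edgeSet → w ∉ e → Disjoint (Metric.closedBall (p w) r) (A e) := by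
    have h1 : ∀ᶠ r : ℝ in 𝓝[>] 0, ∀ u v, u ≠ v →
        Disjoint (Metric.closedBall (p u) r) (Metric.closedBall (p v) r) := by
      simp only [eventually_all]
      intro u v huv
      have hpos : 0 < Dist.dist (p u) (p v) / 2 :=
        half_pos (dist_pos.2 (hp.ne huv))
      filter_upwards [Ioo_mem_nhdsGT hpos] with r hr
      exact Metric.closedBall_disjoint_closedBall (by linarith [hr.2])
    have h2 : ∀ᶠ r : ℝ in 𝓝[>] 0, ∀ w e, e ∈ G.edgeSet → w ∉ e →
        Disjoint (Metric.closedBall (p w) r) (A e) := by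
      simp only [eventually_all]
      intro w e he hw
      exact eventually_disjoint_closedBall (hcpt e he).isClosed fun h => hw (hvert w e he h)
    obtain ⟨r, hr⟩ := (h1.and (h2.and self_mem_nhdsWithin)).exists
    exact ⟨r, hr.2.2, hr.1, hr.2.1⟩
  set U : Set (EuclideanSpace ℝ (Fin 2)) := ⋃ w, Metric.ball (p w) r with hU
  have hUo : IsOpen U := isOpen_iUnion fun w => Metric.isOpen_ball
  -- The mesh is chosen after `r`. Removing the open discs makes the arcs disjoint compact sets,
  -- since different arcs meet only at vertices.
  obtain ⟨R, hR, hR1, hR2, hR3⟩ : ∃ R : ℝ, 0 < R ∧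
      (∀ u v, u ≠ v → ∀ x, x ∈ gridNbhd R (Metric.closedBall (p u) r) →
        x ∉ gridNbhd R (Metric.closedBall (p v) r)) ∧
      (∀ w e, e ∈ G.edgeSet → w ∉ e → ∀ x, x ∈ gridNbhd R (Metric.closedBall (p w) r) →
        x ∉ gridNbhd R (A e)) ∧
      (∀ e f, e ∈ G.edgeSet → f ∈ G.edgeSet → e ≠ f → ∀ x, x ∈ gridNbhd R (A e \ U) →
        x ∉ gridNbhd R (A f \ U)) := by
    have h1 : ∀ᶠ R : ℝ in atTop, ∀ u v, u ≠ v → ∀ x,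
        x ∈ gridNbhd R (Metric.closedBall (p u) r) →
        x ∉ gridNbhd R (Metric.closedBall (p v) r) := by
      rw [eventually_all]; intro u
      rw [eventually_all]; intro v
      rw [eventually_imp_distrib_left]; intro huv
      exact eventually_disjoint_gridNbhd (isCompact_closedBall _ _) (isCompact_closedBall _ _)
        (hr1 u v huv)
    have h2 : ∀ᶠ R : ℝ in atTop, ∀ w e, e ∈ G.edgeSet → w ∉ e → ∀ x,
        x ∈ gridNbhd R (Metric.closedBall (p w) r) → x ∉ gridNbhd R (A e) := by
      rw [eventually_all]; intro w
      rw [eventually_all]; intro e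
      rw [eventually_imp_distrib_left]; intro he
      rw [eventually_imp_distrib_left]; intro hw
      exact eventually_disjoint_gridNbhd (isCompact_closedBall _ _) (hcpt e he) (hr2 w e he hw)
    have h3 : ∀ᶠ R : ℝ in atTop, ∀ e f, e ∈ G.edgeSet → f ∈ G.edgeSet → e ≠ f → ∀ x,
        x ∈ gridNbhd R (A e \ U) → x ∉ gridNbhd R (A f \ U) := by
      rw [eventually_all]; intro e
      rw [eventually_all]; intro f
      rw [eventually_imp_distrib_left]; intro he
      rw [eventually_imp_distrib_left]; intro hf
      rw [eventually_imp_distrib_left]; intro hef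
      refine eventually_disjoint_gridNbhd ((hcpt e he).diff hUo) ((hcpt f hf).diff hUo) ?_
      refine Set.disjoint_left.2 fun y hy hy' => ?_
      obtain ⟨w, -, rfl⟩ := hcross e he f hf hef ⟨hy.1, hy'.1⟩
      exact hy.2 (Set.mem_iUnion.2 ⟨w, Metric.mem_ball_self hr⟩)
    obtain ⟨R, hR⟩ := (h1.and (h2.and (h3.and (eventually_gt_atTop 0)))).exists
    exact ⟨R, hR.2.2.2, hR.1, hR.2.1, hR.2.2.1⟩
  have hmem : ∀ w, p w ∈ Metric.closedBall (p w) r := fun w => Metric.mem_closedBall_self hr.le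
  refine G.isGridMinor_of_sets (fun w => gridNbhd R (Metric.closedBall (p w) r))
    (fun e => gridNbhd R (A e)) (fun w => (round (R * p w 0), round (R * p w 1)))
    (fun w => finite_gridNbhd R Metric.isBounded_closedBall)
    (fun e he => finite_gridNbhd R (hcpt e he).isBounded)
    (fun w => round_mem_gridNbhd (hmem w))
    (fun e he w hw => round_mem_gridNbhd (hend e he w hw))
    (fun w x hx => gridJoined_gridNbhd hR (convex_closedBall _ _).isPreconnected
      (round_mem_gridNbhd (hmem w)) hx)
    (fun e he x hx y hy => gridJoined_gridNbhd hR (hconn e he) hx hy)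
    (fun x u v hu hv => ?_) (fun e he x w hx hw => ?_) (fun e he f hf hef x hx hx' => ?_)
  · by_contra h
    exact hR1 u v h x hu hv
  · by_contra h
    exact hR2 w e he h x hw hx
  · by_contra! hno
    have hout : ∀ K, x ∈ gridNbhd R K → x ∈ gridNbhd R (K \ U) := by
      rintro K ⟨y, hy, hxy⟩
      refine ⟨y, ⟨hy, fun hyU => ?_⟩, hxy⟩
      obtain ⟨w, hw⟩ := Set.mem_iUnion.1 hyU
      exact hno w ⟨y, Metric.ball_subset_closedBall hw, hxy⟩
    exact hR3 e f he hf hef x (hout _ hx) (hout _ hx')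

/-! ### Straight-line drawings and the insertion of a pair of vertices -/

/-- The straight segment (or the point, for a diagonal `e`) that represents `e` when the vertices
are placed at the points `p`. -/
def cellSegment {W : Type*} (p : W → ℂ) (e : Sym2 W) : Set ℂ :=
  {x | ∃ a b, e = s(a, b) ∧ x ∈ segment ℝ (p a) (p b)}

theorem cellSegment_mk {W : Type*} (p : W → ℂ) (a b : W) :
    cellSegment p s(a, b) = segment ℝ (p a) (p b) := by
  ext x
  constructor
  · rintro ⟨c, d, h, hx⟩
    rcases Sym2.eq_iff.1 h with ⟨rfl, rfl⟩ | ⟨rfl, rfl⟩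
    · exact hx
    · rwa [segment_symm]
  · exact fun hx => ⟨a, b, rfl, hx⟩

theorem cellSegment_congr {W : Type*} {p p' : W → ℂ} {e : Sym2 W} (h : ∀ w ∈ e, p w = p' w) :
    cellSegment p e = cellSegment p' e := by
  induction e with
  | h a b => rw [cellSegment_mk, cellSegment_mk, h a (by simp), h b (by simp)]

/-- The points `p` give a straight-line drawing of the vertices and edges in `E`, where the vertex
`a` is in `E` as the diagonal pair `s(a, a)`. -/
def IsStraightDrawing {W : Type*} (E : Set (Sym2 W)) (p : W → ℂ) : Prop :=
  ∀ e ∈ E, ∀ f ∈ E, e ≠ f → ∀ x ∈ cellSegment p e, x ∈ cellSegment p f →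
    ∃ w, w ∈ e ∧ w ∈ f ∧ x = p w

namespace IsStraightDrawing

variable {W : Type*} {E : Set (Sym2 W)} {p : W → ℂ}

theorem mono (h : IsStraightDrawing E p) {E' : Set (Sym2 W)} (hE : E' ⊆ E) :
    IsStraightDrawing E' p := fun e he f hf => h e (hE he) f (hE hf)

theorem mem_of_mem (h : IsStraightDrawing E p) {a : W} (ha : s(a, a) ∈ E) {e : Sym2 W}
    (he : e ∈ E) (hae : p a ∈ cellSegment p e) : a ∈ e := by
  by_cases hea : e = s(a, a)
  · simp [hea]
  obtain ⟨w, hw, hw', -⟩ := h e he _ ha hea (p a) hae (by rw [cellSegment_mk]; simp)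
  simp only [Sym2.mem_iff, or_self] at hw'
  rwa [← hw']

theorem comp_affine (h : IsStraightDrawing E p) (φ : ℂ →ᵃ[ℝ] ℂ) (hφ : Function.Injective φ) :
    IsStraightDrawing E (φ ∘ p) := by
  have him : ∀ e, cellSegment (φ ∘ p) e = φ '' cellSegment p e := fun e => by
    induction e with
    | h a b =>
      rw [cellSegment_mk, cellSegment_mk, image_segment]
      rfl
  intro e he f hf hef x hx hx'
  rw [him] at hx hx'
  obtain ⟨y, hy, rfl⟩ := hx
  obtain ⟨y', hy', hyy'⟩ := hx'
  rw [hφ hyy'] at hy'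
  obtain ⟨w, hw, hw', rfl⟩ := h e he f hf hef y hy hy'
  exact ⟨w, hw, hw', rfl⟩

/-- A new vertex `z` can be drawn at the point `q`, with straight edges to the vertices in `N`, if
these edges do not meet the old drawing or each other outside their ends. -/
theorem insert_vertex [DecidableEq W] (h : IsStraightDrawing E p) (z : W) (hz : ∀ e ∈ E, z ∉ e)
    (N : Set W) (hzN : z ∉ N) (q : ℂ)
    (h1 : ∀ a ∈ N, ∀ e ∈ E, ∀ x ∈ segment ℝ q (p a), x ∈ cellSegment p e → x = p a ∧ a ∈ e)
    (h2 : ∀ e ∈ E, q ∉ cellSegment p e)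
    (h3 : ∀ a ∈ N, ∀ b ∈ N, a ≠ b → ∀ x ∈ segment ℝ q (p a), x ∈ segment ℝ q (p b) → x = q) :
    IsStraightDrawing (E ∪ {e | ∃ a, (a = z ∨ a ∈ N) ∧ e = s(z, a)}) (Function.update p z q) := by
  have hold : ∀ e ∈ E, cellSegment (Function.update p z q) e = cellSegment p e := fun e he =>
    cellSegment_congr fun w hw => Function.update_of_ne (by rintro rfl; exact hz e he hw) _ _
  have hN : ∀ a ∈ N, Function.update p z q a = p a := fun a ha =>
    Function.update_of_ne (by rintro rfl; exact hzN ha) _ _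
  have hnewold : ∀ a, (a = z ∨ a ∈ N) → ∀ f ∈ E, ∀ x,
      x ∈ cellSegment (Function.update p z q) s(z, a) →
      x ∈ cellSegment (Function.update p z q) f →
      ∃ w, w ∈ s(z, a) ∧ w ∈ f ∧ x = Function.update p z q w := by
    intro a ha f hf x hx hx'
    rw [cellSegment_mk, Function.update_self] at hx
    rw [hold f hf] at hx'
    rcases ha with rfl | ha
    · rw [Function.update_self, segment_same, Set.mem_singleton_iff] at hx
      rw [hx] at hx'
      exact absurd hx' (h2 f hf)
    · rw [hN a ha] at hx
      obtain ⟨hxa, haf⟩ := h1 a ha f hf x hx hx'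
      exact ⟨a, by simp, haf, by rw [hN a ha, hxa]⟩
  rintro e (he | ⟨a, ha, rfl⟩) f (hf | ⟨b, hb, rfl⟩) hef x hx hx'
  · rw [hold e he] at hx
    rw [hold f hf] at hx'
    obtain ⟨w, hw, hw', hxw⟩ := h e he f hf hef x hx hx'
    exact ⟨w, hw, hw', by
      rw [Function.update_of_ne (by rintro rfl; exact hz e he hw), hxw]⟩
  · obtain ⟨w, hw, hw', hxw⟩ := hnewold b hb e he x hx' hx
    exact ⟨w, hw', hw, hxw⟩
  · exact hnewold a ha f hf x hx hx'
  · refine ⟨z, by simp, by simp, ?_⟩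
    have hab : a ≠ b := fun h => hef (by rw [h])
    rw [cellSegment_mk, Function.update_self] at hx hx'
    rw [Function.update_self]
    rcases ha with rfl | ha
    · rw [Function.update_self, segment_same] at hx
      exact hx
    rcases hb with rfl | hb
    · rw [Function.update_self, segment_same] at hx'
      exact hx'
    rw [hN a ha] at hx
    rw [hN b hb] at hx'
    exact h3 a ha b hb hab x hx hx'

end IsStraightDrawing

/-- A segment that does not meet the open segment from `0` to `1` does not enter the flat triangles
on this segment. -/
theorem eventually_segment_avoids_triangle (c d : ℂ)
    (h : ∀ x ∈ segment ℝ c d, x.im = 0 → x.re ≤ 0 ∨ 1 ≤ x.re) :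
    ∀ᶠ ε : ℝ in 𝓝[>] 0, ∀ x ∈ segment ℝ c d,
      ¬ (0 < x.im ∧ x.im ≤ ε * x.re ∧ x.im ≤ ε * (1 - x.re)) := by
  have hcoord : ∀ {c d x : ℂ}, x ∈ segment ℝ c d → ∃ t : ℝ, 0 ≤ t ∧ t ≤ 1 ∧
      x.re = c.re + t * (d.re - c.re) ∧ x.im = c.im + t * (d.im - c.im) := by
    intro c d x hx
    rw [segment_eq_image'] at hx
    obtain ⟨t, ⟨h0, h1⟩, rfl⟩ := hx
    exact ⟨t, h0, h1, by simp, by simp⟩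
  -- the case of a segment that starts below the axis and ends above it
  have hcross : ∀ c d : ℂ, c.im ≤ 0 → 0 < d.im →
      (∀ x ∈ segment ℝ c d, x.im = 0 → x.re ≤ 0 ∨ 1 ≤ x.re) →
      ∀ᶠ ε : ℝ in 𝓝[>] 0, ∀ x ∈ segment ℝ c d,
        ¬ (0 < x.im ∧ x.im ≤ ε * x.re ∧ x.im ≤ ε * (1 - x.re)) := by
    intro c d hc hd h
    set l := d.im - c.im with hl
    set k := d.re - c.re with hk
    have hl0 : 0 < l := by linarith
    set t₀ := -c.im / l with ht₀
    have ht₀l : t₀ * l = -c.im := div_mul_cancel₀ _ hl0.ne'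
    have ht0 : 0 ≤ t₀ := div_nonneg (by linarith) hl0.le
    have ht1 : t₀ ≤ 1 := (div_le_one hl0).2 (by linarith)
    have hx₀ := h (c + t₀ • (d - c)) (by
      rw [segment_eq_image']
      exact ⟨t₀, ⟨ht0, ht1⟩, rfl⟩) (by simp; linarith)
    have hre : (c + t₀ • (d - c)).re = c.re + t₀ * k := by simp [hk]
    rw [hre] at hx₀
    -- For `ε` below this value the segment is steeper than the sides of the triangle. As it crosses
    -- the axis outside the open base, it never enters.
    have hpos : 0 < l / (|k| + 1) := by positivity
    filter_upwards [Ioo_mem_nhdsGT hpos] with ε hε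
    have hεk : ε * |k| < l := by
      have := (lt_div_iff₀ (by positivity)).1 hε.2
      nlinarith [hε.1, abs_nonneg k]
    rintro x hx ⟨hx1, hx2, hx3⟩
    obtain ⟨t, -, -, hxr, hxi⟩ := hcoord hx
    have hxi' : x.im = l * (t - t₀) := by rw [hxi]; linarith
    have htt : 0 < t - t₀ := by
      rw [hxi'] at hx1
      exact pos_of_mul_pos_right hx1 hl0.le
    have hbound : ∀ u : ℝ, u ≤ |k| * (t - t₀) → ¬ x.im ≤ ε * u := by
      intro u hu hxu
      have h1 : ε * u ≤ ε * (|k| * (t - t₀)) := mul_le_mul_of_nonneg_left hu hε.1.le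
      have h2 : ε * |k| * (t - t₀) < l * (t - t₀) := mul_lt_mul_of_pos_right hεk htt
      linarith [mul_assoc ε |k| (t - t₀)]
    have hk1 : k * (t - t₀) ≤ |k| * (t - t₀) := mul_le_mul_of_nonneg_right (le_abs_self k) htt.le
    have hk2 : -k * (t - t₀) ≤ |k| * (t - t₀) := mul_le_mul_of_nonneg_right (neg_le_abs k) htt.le
    have hxr' : x.re = c.re + t₀ * k + k * (t - t₀) := by rw [hxr]; ring
    rcases hx₀ with hx₀ | hx₀
    · exact hbound _ (by linarith) hx2
    · exact hbound _ (by linarith) hx3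
  rcases le_or_gt c.im 0 with hc | hc <;> rcases le_or_gt d.im 0 with hd | hd
  · refine Eventually.of_forall fun ε x hx hx' => ?_
    obtain ⟨t, h0, h1, -, hxi⟩ := hcoord hx
    nlinarith [hx'.1]
  · exact hcross c d hc hd h
  · rw [segment_symm] at h ⊢
    exact hcross d c hd hc h
  -- The triangle has height `ε / 2`, so it stays below a segment that lies above the axis.
  · have hm : 0 < min c.im d.im := lt_min hc hd
    filter_upwards [Ioo_mem_nhdsGT hm] with ε hε
    rintro x hx ⟨hx1, hx2, hx3⟩
    obtain ⟨t, h0, h1, -, hxi⟩ := hcoord hx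
    have h2 := min_le_left c.im d.im
    have h3 := min_le_right c.im d.im
    nlinarith [hε.1, hε.2]

theorem IsStraightDrawing.exists_free_triangle {W : Type*} {E : Set (Sym2 W)} (hE : E.Finite)
    {p : W → ℂ} (h : IsStraightDrawing E p) {a b : W} (hab : s(a, b) ∈ E) (ha : p a = 0)
    (hb : p b = 1) : ∃ ε : ℝ, 0 < ε ∧ ∀ e ∈ E, e ≠ s(a, b) → ∀ x ∈ cellSegment p e,
      ¬ (0 < x.im ∧ x.im ≤ ε * x.re ∧ x.im ≤ ε * (1 - x.re)) := by
  have key : ∀ᶠ ε : ℝ in 𝓝[>] 0, ∀ e ∈ E, e ≠ s(a, b) → ∀ x ∈ cellSegment p e,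
      ¬ (0 < x.im ∧ x.im ≤ ε * x.re ∧ x.im ≤ ε * (1 - x.re)) := by
    rw [eventually_all_finite hE]
    intro e he
    rw [eventually_imp_distrib_left]
    intro hne
    induction e with
    | h c d =>
      rw [cellSegment_mk]
      refine eventually_segment_avoids_triangle _ _ fun x hx hxi => ?_
      by_contra! hcon
      have hx' : x ∈ cellSegment p s(a, b) := by
        rw [cellSegment_mk, ha, hb, segment_eq_image']
        refine ⟨x.re, ⟨hcon.1.le, hcon.2.le⟩, ?_⟩
        apply Complex.ext <;> simp [hxi]
      obtain ⟨w, -, hw, rfl⟩ := h _ he _ hab hne x (by rwa [cellSegment_mk]) hx'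
      rcases Sym2.mem_iff.1 hw with rfl | rfl
      · rw [ha] at hcon
        simp at hcon
      · rw [hb] at hcon
        simp at hcon
  obtain ⟨ε, hε⟩ := (key.and self_mem_nhdsWithin).exists
  exact ⟨ε, hε.2, hε.1⟩

theorem exists_of_mem_segment_zero {ε k : ℝ} {x : ℂ}
    (hx : x ∈ segment ℝ (⟨1 / 2, ε * k⟩ : ℂ) 0) :
    ∃ α, 0 ≤ α ∧ α ≤ 1 / 2 ∧ x = ⟨α, ε * (2 * k * α)⟩ := by
  rw [segment_eq_image'] at hx
  obtain ⟨t, ⟨h0, h1⟩, rfl⟩ := hx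
  refine ⟨(1 - t) / 2, by linarith, by linarith, Complex.ext ?_ ?_⟩ <;> simp <;> ring

theorem exists_of_mem_segment_one {ε k : ℝ} {x : ℂ}
    (hx : x ∈ segment ℝ (⟨1 / 2, ε * k⟩ : ℂ) 1) :
    ∃ α, 1 / 2 ≤ α ∧ α ≤ 1 ∧ x = ⟨α, ε * (2 * k * (1 - α))⟩ := by
  rw [segment_eq_image'] at hx
  obtain ⟨t, ⟨h0, h1⟩, rfl⟩ := hx
  refine ⟨(1 + t) / 2, by linarith, by linarith, Complex.ext ?_ ?_⟩ <;> simp <;> ring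

theorem exists_of_mem_segment_vertical {ε k l : ℝ} (hkl : k ≤ l) {x : ℂ}
    (hx : x ∈ segment ℝ (⟨1 / 2, ε * k⟩ : ℂ) ⟨1 / 2, ε * l⟩) :
    ∃ β, k ≤ β ∧ β ≤ l ∧ x = ⟨1 / 2, ε * β⟩ := by
  rw [segment_eq_image'] at hx
  obtain ⟨t, ⟨h0, h1⟩, rfl⟩ := hx
  refine ⟨k + t * (l - k), by nlinarith, by nlinarith, Complex.ext ?_ ?_⟩ <;> simp; ring

theorem mk_eq_mk_iff_of_pos {ε : ℝ} (hε : 0 < ε) {α β α' β' : ℝ} :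
    (⟨α, ε * β⟩ : ℂ) = ⟨α', ε * β'⟩ ↔ α = α' ∧ β = β' := by
  rw [Complex.mk.injEq, mul_right_inj' hε.ne']

/-- Two new vertices `z₀`, `z₁`, joined to each other and to the two ends `u₀`, `u₁` of an edge,
can be added to a straight-line drawing. -/
theorem IsStraightDrawing.exists_insert_pair {W : Type*} [DecidableEq W] {E : Set (Sym2 W)}
    (hE : E.Finite) {p : W → ℂ} (h : IsStraightDrawing E p) {u₀ u₁ z₀ z₁ : W} (hu : u₀ ≠ u₁)
    (h00 : s(u₀, u₀) ∈ E) (h11 : s(u₁, u₁) ∈ E) (h01 : s(u₀, u₁) ∈ E) (hz : z₀ ≠ z₁)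
    (hz₀ : ∀ e ∈ E, z₀ ∉ e) (hz₁ : ∀ e ∈ E, z₁ ∉ e) :
    ∃ p' : W → ℂ, IsStraightDrawing (E ∪ {s(z₀, z₀), s(z₀, u₀), s(z₀, u₁), s(z₁, z₁), s(z₁, u₀),
      s(z₁, u₁), s(z₁, z₀)}) p' := by
  have hpu : p u₀ ≠ p u₁ := by
    intro heq
    have := h.mem_of_mem h00 h11 (by rw [cellSegment_mk, heq]; simp)
    simp [hu] at this
  -- without loss of generality, the edge is the segment from 0 to 1
  obtain ⟨p, h, hp0, hp1⟩ : ∃ p : W → ℂ, IsStraightDrawing E p ∧ p u₀ = 0 ∧ p u₁ = 1 := by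
    have hd : p u₁ - p u₀ ≠ 0 := sub_ne_zero.2 hpu.symm
    set φ : ℂ →ᵃ[ℝ] ℂ := (LinearMap.mulLeft ℝ (p u₁ - p u₀)⁻¹).toAffineMap.comp
      (AffineMap.id ℝ ℂ - AffineMap.const ℝ ℂ (p u₀)) with hφ
    have happ : ∀ x, φ x = (p u₁ - p u₀)⁻¹ * (x - p u₀) := fun x => by simp [hφ]
    refine ⟨φ ∘ p, h.comp_affine φ fun x y hxy => ?_, by simp [happ], ?_⟩
    · rw [happ, happ] at hxy
      simpa using mul_left_cancel₀ (inv_ne_zero hd) hxy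
    · simp only [Function.comp_apply, happ]
      exact inv_mul_cancel₀ hd
  obtain ⟨ε, hε, hfree⟩ := h.exists_free_triangle hE h01 hp0 hp1
  -- In the coordinates `(α, β)`, with heights divided by `ε`, the free triangle has the fixed shape
  -- `0 < β ≤ min α (1 - α)` and the remaining checks are linear arithmetic.
  have hfree' : ∀ e ∈ E, ∀ α β : ℝ, (⟨α, ε * β⟩ : ℂ) ∈ cellSegment p e →
      β ≤ α → β ≤ 1 - α → β ≤ 0 := by
    intro e he α β hx h1 h2
    by_contra! hβ
    by_cases hee : e = s(u₀, u₁)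
    · rw [hee, cellSegment_mk, hp0, hp1, segment_eq_image'] at hx
      obtain ⟨t, -, ht⟩ := hx
      have := congrArg Complex.im ht
      simp at this
      rcases this with h | h <;> linarith
    · refine hfree e he hee _ hx ⟨by positivity, ?_, ?_⟩
      · exact mul_le_mul_of_nonneg_left h1 hε.le
      · exact mul_le_mul_of_nonneg_left h2 hε.le
  have hu0z : u₀ ≠ z₀ := by rintro rfl; exact hz₀ _ h00 (by simp)
  have hu1z : u₁ ≠ z₀ := by rintro rfl; exact hz₀ _ h11 (by simp)
  have hu0z' : u₀ ≠ z₁ := by rintro rfl; exact hz₁ _ h00 (by simp)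
  have hu1z' : u₁ ≠ z₁ := by rintro rfl; exact hz₁ _ h11 (by simp)
  have hend : ∀ k, 0 < k → k ≤ 1 / 2 → ∀ a, a = u₀ ∨ a = u₁ → ∀ e ∈ E,
      ∀ x ∈ segment ℝ (⟨1 / 2, ε * k⟩ : ℂ) (p a), x ∈ cellSegment p e → x = p a ∧ a ∈ e := by
    intro k hk hk' a ha e he x hx hxe
    have haa : s(a, a) ∈ E := by rcases ha with rfl | rfl <;> assumption
    have hxa : x = p a := by
      rcases ha with rfl | rfl
      · rw [hp0] at hx ⊢
        obtain ⟨α, hα0, hα1, rfl⟩ := exists_of_mem_segment_zero hx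
        have := hfree' e he _ _ hxe (by nlinarith) (by nlinarith)
        have : α = 0 := by nlinarith
        simp [this, Complex.ext_iff]
      · rw [hp1] at hx ⊢
        obtain ⟨α, hα0, hα1, rfl⟩ := exists_of_mem_segment_one hx
        have := hfree' e he _ _ hxe (by nlinarith) (by nlinarith)
        have : α = 1 := by nlinarith
        simp [this, Complex.ext_iff]
    exact ⟨hxa, h.mem_of_mem haa he (hxa ▸ hxe)⟩
  have hmeet : ∀ k : ℝ, 0 < k → ∀ x ∈ segment ℝ (⟨1 / 2, ε * k⟩ : ℂ) 0,
      x ∈ segment ℝ (⟨1 / 2, ε * k⟩ : ℂ) 1 → x = ⟨1 / 2, ε * k⟩ := by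
    intro k hk x hx hx'
    obtain ⟨α, hα0, hα1, rfl⟩ := exists_of_mem_segment_zero hx
    obtain ⟨β, hβ0, hβ1, hαβ⟩ := exists_of_mem_segment_one hx'
    obtain ⟨rfl, -⟩ := (mk_eq_mk_iff_of_pos hε).1 hαβ
    obtain rfl : α = 1 / 2 := by linarith
    congr 2
    ring
  -- `z₀` goes to the apex, at `β = 1 / 2`, and `z₁` straight below it, at `β = 1 / 4`. Together
  -- with `u₀` and `u₁` this is the usual plane drawing of the complete graph on four vertices.
  have step1 := h.insert_vertex z₀ hz₀ {u₀, u₁} (by simp [hu0z.symm, hu1z.symm])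
    ⟨1 / 2, ε * (1 / 2)⟩ (fun a ha => hend (1 / 2) (by norm_num) le_rfl a ha)
    (fun e he hq => by
      have := hfree' e he _ _ hq le_rfl (by norm_num)
      norm_num at this)
    (by
      rintro a (rfl | rfl) b (rfl | rfl) hab x hx hx'
      · exact absurd rfl hab
      · rw [hp0] at hx
        rw [hp1] at hx'
        exact hmeet _ (by norm_num) x hx hx'
      · rw [hp1] at hx
        rw [hp0] at hx'
        exact hmeet _ (by norm_num) x hx' hx
      · exact absurd rfl hab)
  set p₁ := Function.update p z₀ ⟨1 / 2, ε * (1 / 2)⟩ with hp₁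
  set E₁ := E ∪ {e | ∃ a, (a = z₀ ∨ a ∈ ({u₀, u₁} : Set W)) ∧ e = s(z₀, a)} with hE₁
  have hp₁z : p₁ z₀ = ⟨1 / 2, ε * (1 / 2)⟩ := Function.update_self ..
  have hp₁0 : p₁ u₀ = 0 := by rw [hp₁, Function.update_of_ne hu0z, hp0]
  have hp₁1 : p₁ u₁ = 1 := by rw [hp₁, Function.update_of_ne hu1z, hp1]
  have hold : ∀ e ∈ E, cellSegment p₁ e = cellSegment p e := fun e he =>
    cellSegment_congr fun w hw => Function.update_of_ne (by rintro rfl; exact hz₀ e he hw) _ _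
  -- the cells at `z₀`, as seen from the new edges at `z₁`
  have hcell : ∀ a, (a = z₀ ∨ a = u₀ ∨ a = u₁) → ∀ x ∈ cellSegment p₁ s(z₀, a),
      ∃ α β : ℝ, x = ⟨α, ε * β⟩ ∧ ((a = z₀ ∧ α = 1 / 2 ∧ β = 1 / 2 ∧ 0 ≤ α) ∨
        (a = u₀ ∧ α ≤ 1 / 2 ∧ β = α ∧ 0 ≤ α) ∨ (a = u₁ ∧ 1 / 2 ≤ α ∧ β = 1 - α ∧ α ≤ 1)) := by
    rintro a (rfl | rfl | rfl) x hx
    · rw [cellSegment_mk, segment_same, hp₁z, Set.mem_singleton_iff] at hx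
      exact ⟨1 / 2, 1 / 2, hx, Or.inl ⟨rfl, rfl, rfl, by norm_num⟩⟩
    · rw [cellSegment_mk, hp₁z, hp₁0] at hx
      obtain ⟨α, hα0, hα1, rfl⟩ := exists_of_mem_segment_zero hx
      exact ⟨α, _, rfl, Or.inr (Or.inl ⟨rfl, hα1, by ring, hα0⟩)⟩
    · rw [cellSegment_mk, hp₁z, hp₁1] at hx
      obtain ⟨α, hα0, hα1, rfl⟩ := exists_of_mem_segment_one hx
      exact ⟨α, _, rfl, Or.inr (Or.inr ⟨rfl, hα0, by ring, hα1⟩)⟩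
  have hnew : ∀ a, (a = u₀ ∨ a = u₁ ∨ a = z₀) →
      ∀ x ∈ segment ℝ (⟨1 / 2, ε * (1 / 4)⟩ : ℂ) (p₁ a), ∃ α β : ℝ, x = ⟨α, ε * β⟩ ∧
        ((a = z₀ ∧ α = 1 / 2 ∧ 1 / 4 ≤ β ∧ β ≤ 1 / 2) ∨
        (a = u₀ ∧ α ≤ 1 / 2 ∧ β = α / 2 ∧ 0 ≤ α) ∨
        (a = u₁ ∧ 1 / 2 ≤ α ∧ β = (1 - α) / 2 ∧ α ≤ 1)) := by
    rintro a (rfl | rfl | rfl) x hx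
    · rw [hp₁0] at hx
      obtain ⟨α, hα0, hα1, rfl⟩ := exists_of_mem_segment_zero hx
      exact ⟨α, _, rfl, Or.inr (Or.inl ⟨rfl, hα1, by ring, hα0⟩)⟩
    · rw [hp₁1] at hx
      obtain ⟨α, hα0, hα1, rfl⟩ := exists_of_mem_segment_one hx
      exact ⟨α, _, rfl, Or.inr (Or.inr ⟨rfl, hα0, by ring, hα1⟩)⟩
    · rw [hp₁z] at hx
      obtain ⟨β, hβ0, hβ1, rfl⟩ := exists_of_mem_segment_vertical (by norm_num) hx
      exact ⟨1 / 2, β, rfl, Or.inl ⟨rfl, rfl, hβ0, hβ1⟩⟩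
  have step2 := step1.insert_vertex z₁ (by
      rintro e (he | ⟨a, ha, rfl⟩)
      · exact hz₁ e he
      · rw [Sym2.mem_iff, not_or]
        refine ⟨hz.symm, ?_⟩
        rcases ha with rfl | rfl | rfl
        · exact hz.symm
        · exact hu0z'.symm
        · exact hu1z'.symm)
    {u₀, u₁, z₀} (by simp [hu0z'.symm, hu1z'.symm, hz.symm]) ⟨1 / 2, ε * (1 / 4)⟩
    (by
      rintro a ha e (he | ⟨b, hb, rfl⟩) x hx hxe
      · rw [hold e he] at hxe
        rcases ha with rfl | rfl | rfl
        · rw [hp₁0, ← hp0] at hx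
          rw [hp₁0, ← hp0]
          exact hend (1 / 4) (by norm_num) (by norm_num) _ (Or.inl rfl) e he x hx hxe
        · rw [hp₁1, ← hp1] at hx
          rw [hp₁1, ← hp1]
          exact hend (1 / 4) (by norm_num) (by norm_num) _ (Or.inr rfl) e he x hx hxe
        · exfalso
          rw [hp₁z] at hx
          obtain ⟨β, hβ0, hβ1, rfl⟩ := exists_of_mem_segment_vertical (by norm_num) hx
          have := hfree' e he _ _ hxe hβ1 (by linarith)
          linarith
      · obtain ⟨α, β, rfl, hαβ⟩ := hnew a ha x hx
        obtain ⟨α', β', heq, hαβ'⟩ := hcell b hb _ hxe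
        obtain ⟨rfl, rfl⟩ := (mk_eq_mk_iff_of_pos hε).1 heq
        rcases hαβ with ⟨rfl, h⟩ | ⟨rfl, h⟩ | ⟨rfl, h⟩ <;>
        rcases hαβ' with ⟨rfl, h'⟩ | ⟨rfl, h'⟩ | ⟨rfl, h'⟩ <;>
        first
          | exfalso
            linarith only [h.1, h.2.1, h.2.2, h'.1, h'.2.1, h'.2.2]
          | refine ⟨?_, by simp⟩
            first | rw [hp₁z] | rw [hp₁0] | rw [hp₁1]
            apply Complex.ext <;> simp only [Complex.zero_re, Complex.zero_im, Complex.one_re,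
              Complex.one_im, mul_eq_zero, hε.ne', false_or, mul_right_inj' hε.ne'] <;>
            linarith only [h.1, h.2.1, h.2.2, h'.1, h'.2.1, h'.2.2])
    (by
      rintro e (he | ⟨b, hb, rfl⟩) hq
      · rw [hold e he] at hq
        have := hfree' e he _ _ hq (by norm_num) (by norm_num)
        norm_num at this
      · obtain ⟨α', β', heq, hαβ'⟩ := hcell b hb _ hq
        obtain ⟨rfl, rfl⟩ := (mk_eq_mk_iff_of_pos hε).1 heq
        rcases hαβ' with h | h | h <;> linarith [h.2.1, h.2.2.1])
    (by
      intro a ha b hb hab x hx hx'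
      obtain ⟨α, β, rfl, hαβ⟩ := hnew a ha x hx
      obtain ⟨α', β', heq, hαβ'⟩ := hnew b hb _ hx'
      obtain ⟨rfl, rfl⟩ := (mk_eq_mk_iff_of_pos hε).1 heq
      rw [mk_eq_mk_iff_of_pos hε]
      rcases hαβ with ⟨ha, h⟩ | ⟨ha, h⟩ | ⟨ha, h⟩ <;>
      rcases hαβ' with ⟨hb, h'⟩ | ⟨hb, h'⟩ | ⟨hb, h'⟩ <;>
      first
        | exact absurd (ha.trans hb.symm) hab
        | constructor <;> linarith only [h.1, h.2.1, h.2.2, h'.1, h'.2.1, h'.2.2])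
  refine ⟨_, step2.mono ?_⟩
  rintro e (he | rfl | rfl | rfl | rfl | rfl | rfl | rfl)
  · exact Or.inl (Or.inl he)
  · exact Or.inl (Or.inr ⟨_, Or.inl rfl, rfl⟩)
  · exact Or.inl (Or.inr ⟨_, Or.inr (Or.inl rfl), rfl⟩)
  · exact Or.inl (Or.inr ⟨_, Or.inr (Or.inr rfl), rfl⟩)
  · exact Or.inr ⟨_, Or.inl rfl, rfl⟩
  · exact Or.inr ⟨_, Or.inr (Or.inl rfl), rfl⟩
  · exact Or.inr ⟨_, Or.inr (Or.inr (Or.inl rfl)), rfl⟩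
  · exact Or.inr ⟨_, Or.inr (Or.inr (Or.inr rfl)), rfl⟩

/-! ### Drawing the double of a forest -/

/-- The vertices and edges over `s` of the strong product of `H` with a single edge. -/
def doubledCells {V : Type*} (H : SimpleGraph V) (s : Finset V) : Set (Sym2 (V × Bool)) :=
  {e | ∃ a b : V × Bool, e = s(a, b) ∧ a.1 ∈ s ∧ b.1 ∈ s ∧ (a.1 = b.1 ∨ H.Adj a.1 b.1)}

theorem mk_mem_doubledCells {V : Type*} {H : SimpleGraph V} {s : Finset V} {a b : V × Bool} :
    s(a, b) ∈ doubledCells H s ↔ a.1 ∈ s ∧ b.1 ∈ s ∧ (a.1 = b.1 ∨ H.Adj a.1 b.1) := by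
  constructor
  · rintro ⟨c, d, h, hc, hd, hcd⟩
    rcases Sym2.eq_iff.1 h with ⟨rfl, rfl⟩ | ⟨rfl, rfl⟩
    · exact ⟨hc, hd, hcd⟩
    · exact ⟨hd, hc, hcd.imp Eq.symm SimpleGraph.Adj.symm⟩
  · exact fun h => ⟨a, b, rfl, h⟩

theorem fst_mem_of_mem_doubledCells {V : Type*} {H : SimpleGraph V} {s : Finset V}
    {e : Sym2 (V × Bool)} (he : e ∈ doubledCells H s) {a : V × Bool} (ha : a ∈ e) : a.1 ∈ s := by
  obtain ⟨c, d, rfl, hc, hd, -⟩ := he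
  rcases Sym2.mem_iff.1 ha with rfl | rfl <;> assumption

/-- Among any two or more vertices of a forest there is one, `v`, with at most one neighbour `u`
among them. -/
theorem SimpleGraph.IsAcyclic.exists_leaf {V : Type*} {H : SimpleGraph V} (hH : H.IsAcyclic)
    (s : Finset V) (hs : 2 ≤ s.card) :
    ∃ v ∈ s, ∃ u ∈ s, u ≠ v ∧ ∀ w ∈ s, H.Adj v w → w = u := by
  classical
  have : Nontrivial (s : Set V) := by
    exact (Finset.one_lt_card_iff_nontrivial.1 hs).coe_sort
  -- The induced forest is extended to a spanning tree on `s`, whose leaf serves as `v`; isolated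
  -- vertices need no separate case, since `u` need not be adjacent to `v` in `H`.
  obtain ⟨T, hHT, -, hT⟩ := (SimpleGraph.connected_top (V := (s : Set V)))
    |>.exists_isTree_le_of_le_of_isAcyclic (le_top (a := H.induce (s : Set V))) (hH.induce _)
  obtain ⟨v, hv⟩ := hT.exists_vert_degree_one_of_nontrivial
  rw [SimpleGraph.degree_eq_one_iff_existsUnique_adj] at hv
  obtain ⟨u, huv, hu⟩ := hv
  refine ⟨v, v.2, u, u.2, fun h => huv.ne (Subtype.ext h).symm, fun w hw hvw => ?_⟩
  exact congrArg Subtype.val (hu ⟨w, hw⟩ (hHT hvw))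

/-- Induction by removing a leaf `v` attached at `u`: its two copies are inserted next to the
segment joining the copies of `u`, which `doubledCells` contains for this purpose. -/
theorem exists_isStraightDrawing_doubledCells {V : Type*} {H : SimpleGraph V} (hH : H.IsAcyclic)
    (s : Finset V) (hs : s.Nonempty) :
    ∃ p : V × Bool → ℂ, IsStraightDrawing (doubledCells H s) p := by
  classical
  induction hn : s.card using Nat.strong_induction_on generalizing s with
  | _ n ih =>
  by_cases h2 : 2 ≤ s.card
  · obtain ⟨v, hv, u, hu, huv, hleaf⟩ := hH.exists_leaf s h2
    have hus : u ∈ s.erase v := Finset.mem_erase.2 ⟨huv, hu⟩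
    have hcard := Finset.card_erase_of_mem hv
    obtain ⟨p, hp⟩ := ih (s.erase v).card (by omega) (s.erase v) ⟨u, hus⟩ rfl
    have hmem : ∀ i j, s((u, i), (u, j)) ∈ doubledCells H (s.erase v) := fun i j =>
      mk_mem_doubledCells.2 ⟨hus, hus, Or.inl rfl⟩
    have hnot : ∀ i, ∀ e ∈ doubledCells H (s.erase v), (v, i) ∉ e := fun i e he hve =>
      Finset.notMem_erase v s (fst_mem_of_mem_doubledCells he hve)
    have hfin : (doubledCells H (s.erase v)).Finite := by
      refine (((s.erase v) ×ˢ Finset.univ).sym2.finite_toSet).subset fun e he => ?_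
      rw [Finset.mem_coe, Finset.mem_sym2_iff]
      exact fun a ha => Finset.mem_product.2
        ⟨fst_mem_of_mem_doubledCells he ha, Finset.mem_univ _⟩
    obtain ⟨p', hp'⟩ := hp.exists_insert_pair hfin (u₀ := (u, false)) (u₁ := (u, true))
      (z₀ := (v, false)) (z₁ := (v, true)) (by simp) (hmem _ _) (hmem _ _) (hmem _ _) (by simp)
      (hnot _) (hnot _)
    refine ⟨p', hp'.mono ?_⟩
    have key : ∀ (a b : V × Bool), a.1 = v → b.1 ∈ s → (a.1 = b.1 ∨ H.Adj a.1 b.1) →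
        s(a, b) ∈ ({s((v, false), (v, false)), s((v, false), (u, false)), s((v, false), (u, true)),
          s((v, true), (v, true)), s((v, true), (u, false)), s((v, true), (u, true)),
          s((v, true), (v, false))} : Set (Sym2 (V × Bool))) := by
      rintro ⟨a, i⟩ ⟨b, j⟩ rfl hb hab
      rcases hab with hab | hab
      · simp only at hab
        subst hab
        cases i <;> cases j <;> simp
      · obtain rfl := hleaf b hb hab
        cases i <;> cases j <;> simp
    rintro e ⟨a, b, rfl, ha, hb, hab⟩
    by_cases hav : a.1 = v
    · exact Or.inr (key a b hav hb hab)
    by_cases hbv : b.1 = v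
    · rw [show s(a, b) = s(b, a) from Sym2.eq_swap]
      exact Or.inr (key b a hbv ha (hab.imp Eq.symm SimpleGraph.Adj.symm))
    exact Or.inl (mk_mem_doubledCells.2
      ⟨Finset.mem_erase.2 ⟨hav, ha⟩, Finset.mem_erase.2 ⟨hbv, hb⟩, hab⟩)
  · have h1 : s.card = 1 := by
      have := hs.card_pos
      omega
    obtain ⟨v, rfl⟩ := Finset.card_eq_one.1 h1
    have h0 : IsStraightDrawing (∅ : Set (Sym2 (V × Bool))) (fun _ => 0) := fun e he => he.elim
    have step := h0.insert_vertex (v, false) (by simp) ∅ (by simp) 0 (by simp) (by simp) (by simp)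
    refine ⟨_, (step.insert_vertex (v, true) (by simp) {(v, false)} (by simp) 1 ?_ ?_ ?_).mono ?_⟩
    · rintro a rfl e (he | ⟨b, rfl | hb, rfl⟩) x hx hxe
      · exact he.elim
      · rw [cellSegment_mk, segment_same] at hxe
        exact ⟨hxe, by simp⟩
      · exact hb.elim
    · rintro e (he | ⟨b, rfl | hb, rfl⟩) hxe
      · exact he.elim
      · rw [cellSegment_mk, segment_same, Function.update_self] at hxe
        exact one_ne_zero hxe
      · exact hb.elim
    · rintro a rfl b rfl hab
      exact absurd rfl hab
    · rintro e ⟨⟨a, i⟩, ⟨b, j⟩, rfl, ha, hb, -⟩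
      simp only [Finset.mem_singleton] at ha hb
      subst ha hb
      cases i <;> cases j <;> simp

theorem isPlaneArc_segment {a b : EuclideanSpace ℝ (Fin 2)} (h : a ≠ b) :
    IsPlaneArc a b (segment ℝ a b) :=
  ⟨Path.segment a b, Path.segment_injective_of_ne h, Path.range_segment a b⟩

/-- A graph with a straight-line drawing in the complex plane is planar. -/
theorem IsStraightDrawing.isPlanarGraph {W : Type*} {G : SimpleGraph W} {E : Set (Sym2 W)}
    {p : W → ℂ} (h : IsStraightDrawing E p) (hV : ∀ w, s(w, w) ∈ E) (hE : G.edgeSet ⊆ E) :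
    G.IsPlanarGraph := by
  set φ : ℂ ≃ₗᵢ[ℝ] EuclideanSpace ℝ (Fin 2) := Complex.orthonormalBasisOneI.repr with hφ
  have hinj : Function.Injective p := by
    intro a b hab
    have := h.mem_of_mem (hV a) (hV b) (by rw [cellSegment_mk, hab]; simp)
    simpa using this
  refine ⟨fun w => φ (p w), fun e => φ '' cellSegment p e, φ.injective.comp hinj,
    fun u v huv => ?_, fun w e he hw => ?_, fun e he f hf hef => ?_⟩
  · have him : φ '' cellSegment p s(u, v) = segment ℝ (φ (p u)) (φ (p v)) := by
      rw [cellSegment_mk]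
      exact image_segment ℝ φ.toLinearEquiv.toLinearMap.toAffineMap _ _
    simp only [him]
    exact isPlaneArc_segment fun h => huv.ne (hinj (φ.injective h))
  · obtain ⟨x, hx, hxw⟩ := hw
    rw [φ.injective hxw] at hx
    exact h.mem_of_mem (hV w) (hE he) hx
  · rintro _ ⟨⟨x, hx, rfl⟩, ⟨y, hy, hxy⟩⟩
    rw [φ.injective hxy] at hy
    obtain ⟨w, hw, hw', rfl⟩ := h e (hE he) f (hE hf) hef x hx hy
    exact ⟨w, ⟨hw, hw'⟩, rfl⟩

/-! ### Thickness, arboricity and the two bounds -/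

namespace SimpleGraph

theorem IsAcyclic.isPlanarGraph_doubled {V : Type*} [Finite V] [Nonempty V] {H : SimpleGraph V}
    (hH : H.IsAcyclic) : H.doubled.IsPlanarGraph := by
  have := Fintype.ofFinite V
  obtain ⟨p, hp⟩ := exists_isStraightDrawing_doubledCells hH Finset.univ Finset.univ_nonempty
  refine hp.isPlanarGraph (fun w => mk_mem_doubledCells.2 (by simp)) fun e he => ?_
  induction e with
  | h a b => exact mk_mem_doubledCells.2 ⟨Finset.mem_univ _, Finset.mem_univ _, Or.inr he⟩

theorem IsPlanarGraph.comap {V W : Type*} {G : SimpleGraph W} (hG : G.IsPlanarGraph)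
    {f : V → W} (hf : Function.Injective f) : (G.comap f).IsPlanarGraph := by
  obtain ⟨p, A, hp, harc, hvert, hcross⟩ := hG
  have hE : ∀ e ∈ (G.comap f).edgeSet, Sym2.map f e ∈ G.edgeSet := fun e he => by
    induction e with | h a b => exact he
  have hmem : ∀ w e, f w ∈ Sym2.map f e → w ∈ e := fun w e h => by
    obtain ⟨a, ha, haw⟩ := Sym2.mem_map.1 h
    rwa [← hf haw]
  refine ⟨p ∘ f, fun e => A (Sym2.map f e), hp.comp hf, fun u v huv => harc _ _ huv,
    fun w e he hw => hmem w e (hvert _ _ (hE e he) hw), fun e he g hg heg x hx => ?_⟩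
  obtain ⟨w, ⟨hw, hw'⟩, rfl⟩ := hcross _ (hE e he) _ (hE g hg)
    (fun h => heg (Sym2.map.injective hf h)) hx
  obtain ⟨v, hv, rfl⟩ := Sym2.mem_map.1 hw
  exact ⟨v, ⟨hv, hmem v g hw'⟩, rfl⟩

theorem IsAcyclic.isPlanarGraph {V : Type*} [Finite V] [Nonempty V] {H : SimpleGraph V}
    (hH : H.IsAcyclic) : H.IsPlanarGraph :=
  hH.isPlanarGraph_doubled.comap (f := fun v => (v, false)) fun _ _ h => congrArg Prod.fst h

theorem four_le_egirth_iff {V : Type*} {G : SimpleGraph V} :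
    4 ≤ G.egirth ↔ ∀ a b c, G.Adj a b → G.Adj b c → G.Adj c a → False := by
  classical
  constructor
  · intro h a b c hab hbc hca
    obtain ⟨u, w, hw, hlen⟩ := is3Clique_iff_exists_cycle_length_three.1
      ⟨{a, b, c}, is3Clique_triple_iff.2 ⟨hab, hca.symm, hbc⟩⟩
    have := le_egirth.1 h u w hw
    rw [hlen] at this
    exact absurd this (by decide)
  · intro h
    rw [le_egirth]
    intro u w hw
    have h3 := hw.three_le_length
    by_contra hlt
    have hlen : w.length = 3 := by
      have : w.length < 4 := by exact_mod_cast not_le.1 hlt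
      omega
    obtain ⟨t, ht⟩ := is3Clique_iff_exists_cycle_length_three.2 ⟨u, w, hw, hlen⟩
    obtain ⟨a, b, c, hab, hac, hbc, -⟩ := is3Clique_iff.1 ht
    exact h a b c hab hbc hac.symm

theorem four_le_egirth_doubled {V : Type*} {G : SimpleGraph V} (h : 4 ≤ G.egirth) :
    4 ≤ G.doubled.egirth := by
  rw [four_le_egirth_iff] at h ⊢
  exact fun a b c hab hbc hca => h a.1 b.1 c.1 hab hbc hca

theorem doubled_iSup {V ι : Type*} (H : ι → SimpleGraph V) :
    (⨆ i, H i).doubled = ⨆ i, (H i).doubled := by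
  ext a b
  simp [doubled]

theorem girthThickness_top_eq_arboricity {V : Type*} [Finite V] [Nonempty V]
    (G : SimpleGraph V) : G.girthThickness ⊤ = G.arboricity := by
  have key : ∀ H : SimpleGraph V, (H.IsPlanarGraph ∧ ⊤ ≤ H.egirth) ↔ H.IsAcyclic := fun H => by
    rw [top_le_iff, egirth_eq_top]
    exact ⟨fun h => h.2, fun h => ⟨h.isPlanarGraph, h⟩⟩
  simp only [girthThickness, arboricity, key]

theorem girthThickness_four_doubled_le {V : Type*} [Finite V] [Nonempty V]
    (G : SimpleGraph V) : G.doubled.girthThickness 4 ≤ G.girthThickness ⊤ := by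
  refine le_iInf₂ fun k ⟨H, hH, hG⟩ => ?_
  refine iInf₂_le k ⟨fun i => (H i).doubled, fun i => ⟨?_, ?_⟩, by rw [← doubled_iSup, hG]⟩
  · exact (egirth_eq_top.1 (top_le_iff.1 (hH i).2)).isPlanarGraph_doubled
  · exact four_le_egirth_doubled (le_top.trans (hH i).2)

theorem ncard_edgeSet_doubled {V : Type*} [Finite V] (G : SimpleGraph V) :
    G.doubled.edgeSet.ncard = 4 * G.edgeSet.ncard := by
  classical
  have := Fintype.ofFinite V
  have h1 := G.sum_degrees_eq_twice_card_edges
  have h2 := G.doubled.sum_degrees_eq_twice_card_edges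
  have hdeg : ∀ a : V × Bool, G.doubled.degree a = 2 * G.degree a.1 := by
    intro a
    have : G.doubled.neighborFinset a = G.neighborFinset a.1 ×ˢ Finset.univ := by
      ext b
      simp only [mem_neighborFinset, Finset.mem_product, Finset.mem_univ, and_true]
      rfl
    rw [← card_neighborFinset_eq_degree, this, Finset.card_product, card_neighborFinset_eq_degree]
    simp [mul_comm]
  simp only [hdeg] at h2
  rw [Fintype.sum_prod_type, Finset.sum_comm, Fintype.sum_bool, ← Finset.mul_sum, h1] at h2
  rw [← coe_edgeFinset, ← coe_edgeFinset, Set.ncard_coe_finset, Set.ncard_coe_finset]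
  omega

/-- A finite planar graph of girth at least 4 with `n ≥ 3` vertices has at most `2n - 4` edges. -/
theorem IsPlanarGraph.ncard_edgeSet_add_four_le {V : Type*} [Finite V] {G : SimpleGraph V}
    (hG : G.IsPlanarGraph) (hg : 4 ≤ G.egirth) (hn : 3 ≤ Nat.card V) :
    G.edgeSet.ncard + 4 ≤ 2 * Nat.card V := by
  classical
  have := Fintype.ofFinite V
  rw [Nat.card_eq_fintype_card] at hn ⊢
  rw [← Nat.card_coe_set_eq, Nat.card_eq_fintype_card]
  exact hG.isGridMinor.card_edgeSet_add_four_le (four_le_egirth_iff.1 hg) hn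

theorem ceil_le_girthThickness_four_doubled {V : Type*} [Finite V] (G : SimpleGraph V)
    (hn : 2 ≤ Nat.card V) :
    ((⌈(G.edgeSet.ncard : ℚ) / ((Nat.card V : ℚ) - 1)⌉₊ : ℕ) : ℕ∞) ≤
      G.doubled.girthThickness 4 := by
  refine le_iInf₂ fun k ⟨H, hH, hG⟩ => ?_
  have hW : Nat.card (V × Bool) = 2 * Nat.card V := by simp [Nat.card_prod, mul_comm]
  -- The bound `2m - 4` with `m = 2n`; it applies because `n ≥ 2` gives `m ≥ 4`.
  have hi : ∀ i, (H i).edgeSet.ncard ≤ 4 * (Nat.card V - 1) := fun i => by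
    have := (hH i).1.ncard_edgeSet_add_four_le (hH i).2 (by omega)
    omega
  have hsum : G.doubled.edgeSet.ncard ≤ k * (4 * (Nat.card V - 1)) := by
    rw [← hG, edgeSet_iSup]
    refine (Set.ncard_iUnion_le_of_fintype _).trans ?_
    refine (Finset.sum_le_sum fun i _ => hi i).trans ?_
    simp
  rw [ncard_edgeSet_doubled] at hsum
  have hle : G.edgeSet.ncard ≤ k * (Nat.card V - 1) := by
    have : k * (4 * (Nat.card V - 1)) = 4 * (k * (Nat.card V - 1)) := by ring
    omega
  have hpos : (0 : ℚ) < (Nat.card V : ℚ) - 1 := by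
    have : (2 : ℚ) ≤ Nat.card V := by exact_mod_cast hn
    linarith
  rw [Nat.cast_le, Nat.ceil_le, div_le_iff₀ hpos]
  have : ((G.edgeSet.ncard : ℕ) : ℚ) ≤ ((k * (Nat.card V - 1) : ℕ) : ℚ) := by exact_mod_cast hle
  rwa [Nat.cast_mul, Nat.cast_sub (by omega), Nat.cast_one] at this

end SimpleGraph

theorem theorem1 {V : Type*} [Finite V] (G : SimpleGraph V) (hn : 2 ≤ Nat.card V) :
    ((⌈(G.edgeSet.ncard : ℚ) / ((Nat.card V : ℚ) - 1)⌉₊ : ℕ) : ℕ∞) ≤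
        G.doubled.girthThickness 4 ∧
      G.doubled.girthThickness 4 ≤ G.girthThickness ⊤ ∧
      G.girthThickness ⊤ = G.arboricity := by
  have : Nonempty V := (Nat.card_pos_iff.1 (by omega)).1
  exact ⟨G.ceil_le_girthThickness_four_doubled hn, G.girthThickness_four_doubled_le,
    G.girthThickness_top_eq_arboricity⟩
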